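/- Let $q\in\mathbb{C}^\times$ not be a root of unity. Let $\mathcal{O}_q(\mathrm{Mat}_2)$ be the $\mathbb{C}$-algebra generated by $a,b,c,d$ with relations $$ab=qba,\quad ac=qca,\quad bc=cb,\quad bd=qdb,\quad cd=qdc,\quad ad-da=(q-q^{-1})bc,$$ and let $\mathcal{O}_q(\mathrm{SL}_2)=\mathcal{O}_q(\mathrm{Mat}_2)/\langle ad-qbc-1\rangle$. Let $U_q(\mathfrak{sl}_2)$ be generated by $E,F,K^{\pm1}$ with relations $KE=q^2EK$, $KF=q^{-2}FK$, $EF-FE=(K-K^{-1})/(q-q^{-1})$ and comultiplication $\Delta(E)=E\otimes 1+K\otimes E$, $\Delta(F)=F\otimes K^{-1}+1\otimes F$, $\Delta(K)=K\otimes K$, and for $m\ge 0$ let $\mathcal{V}_m$ be its simple module of type $\mathbf 1$ and dimension $m+1$. Identify $\mathcal{O}_q(\mathrm{SL}_2)$ with the algebra of matrix coefficients in $U_q(\mathfrak{sl}_2)^*$ by sending $a,b,c,d$ to the entries $c_{11},c_{12},c_{21},c_{22}$ of the matrix of $\mathcal{V}_1$ in a weight basis $v_1,\ v_2=Fv_1$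 with $v_1$ of highest weight. For $n\in\mathbb{Z}$ let $\mathcal{O}_q(\mathrm{SL}_2)_{\le n}$ be the span of the matrix coefficients of the modules $\mathcal{V}_m$ with $m\le n$ in the dominance order on $\mathbb{Z}$ (that is, $n-m$ is a nonnegative even integer), and let $\mathcal{O}_q(\mathrm{SL}_2)_{<n}=\sum_{m<n}\mathcal{O}_q(\mathrm{SL}_2)_{\le m}$. Let $\mathrm{Sym}_q^k(\mathbb{C}^2)$ be the component of degree $k$ of $\mathbb{C}\langle x,y\rangle/\langle xy-qyx\rangle$, and for the second copy of this algebra write $(u,w)$ for $(x,y)$. Then these subspaces form an algebra filtration of $\mathcal{O}_q(\mathrm{SL}_2)$ by $\mathbb{Z}$ with the dominance order (the Peter–Weyl filtration), and there are isomorphisms of graded $\mathbb{C}$-algebras $$\mathrm{gr}(\mathcal{O}_q(\mathrm{SL}_2))=\bigoplus_{n\in\mathbb{Z}}\mathcal{O}_q(\mathrm{SL}_2)_{\le n}/\mathcal{O}_q(\mathrm{SL}_2)_{<n}\;\simeq\;\mathcal{O}_q(\mathrm{Mat}_2)/\langle ad-qbc\rangle\;\simeq\;\bigoplus_{k\ge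 0}\mathrm{Sym}_q^k(\mathbb{C}^2)\otimes\mathrm{Sym}_q^k(\mathbb{C}^2),$$ where the generators $a,b,c,d$ of the middle algebra have degree $1$. The first isomorphism sends the classes of $a,b,c,d\in\mathcal{O}_q(\mathrm{SL}_2)_{\le 1}$ to $a,b,c,d$, and the second is given by $a\mapsto x\otimes u$, $b\mapsto x\otimes w$, $c\mapsto y\otimes u$, $d\mapsto y\otimes w$. The last algebra is called $\mathbb{P}^1_q\times\mathbb{P}^1_q$. -/

import Mathlib

open scoped TensorProduct DirectSum

noncomputable section

namespace QuantumSL2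

section AssociatedGraded

variable {ι k A : Type*} [PartialOrder ι] [CommRing k] [Ring A] [Algebra k A]

/-- `F_{< i}`, the sum of the `F_j` with `j < i`. -/
def filtrationLT (F : ι → Submodule k A) (i : ι) : Submodule k A := ⨆ j, ⨆ _ : j < i, F j

/-- The component `F_i / F_{< i}` of the associated graded algebra. -/
def GrPiece (F : ι → Submodule k A) (i : ι) : Type _ :=
  F i ⧸ (filtrationLT F i).submoduleOf (F i)

instance (F : ι → Submodule k A) (i : ι) : AddCommGroup (GrPiece F i) :=
  inferInstanceAs (AddCommGroup (F i ⧸ (filtrationLT F i).submoduleOf (F i)))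

instance (F : ι → Submodule k A) (i : ι) : Module k (GrPiece F i) :=
  inferInstanceAs (Module k (F i ⧸ (filtrationLT F i).submoduleOf (F i)))

/-- The symbol in `F_i / F_{< i}` of an element of `F_i`. -/
def grMk (F : ι → Submodule k A) (i : ι) : F i →ₗ[k] GrPiece F i :=
  ((filtrationLT F i).submoduleOf (F i)).mkQ

variable (F : ι → Submodule k A)

theorem grMk_surjective (i : ι) : Function.Surjective (grMk F i) :=
  Submodule.mkQ_surjective _

theorem grMk_congr {i j : ι} (h : i = j) (x : F i) (y : F j) (hxy : (x : A) = y) :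
    GradedMonoid.mk (A := GrPiece F) i (grMk F i x) = GradedMonoid.mk j (grMk F j y) := by
  subst h
  rw [Subtype.ext hxy]

variable [AddCommMonoid ι] [IsOrderedCancelAddMonoid ι] [IsRingFiltration F (filtrationLT F)]

theorem filtrationLT_mul_mem {i j : ι} {x y : A} (hx : x ∈ filtrationLT F i) (hy : y ∈ F j) :
    x * y ∈ filtrationLT F (i + j) := by
  have : filtrationLT F i ≤ (filtrationLT F (i + j)).comap (LinearMap.mulRight k y) :=
    iSup₂_le fun l hl z hz =>
      IsFiltration.is_le (F := F) (add_lt_add_left hl j) (SetLike.mul_mem_graded hz hy)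
  exact this hx

theorem mul_filtrationLT_mem {i j : ι} {x y : A} (hx : x ∈ F i) (hy : y ∈ filtrationLT F j) :
    x * y ∈ filtrationLT F (i + j) := by
  have : filtrationLT F j ≤ (filtrationLT F (i + j)).comap (LinearMap.mulLeft k x) :=
    iSup₂_le fun l hl z hz =>
      IsFiltration.is_le (F := F) (add_lt_add_right hl i) (SetLike.mul_mem_graded hx hz)
  exact this hy

/-- The multiplication `F_i × F_j → F_{i+j}`. -/
def filtrationMul (i j : ι) : F i →ₗ[k] F j →ₗ[k] F (i + j) :=
  LinearMap.mk₂ k (fun x y => ⟨x * y, SetLike.mul_mem_graded x.2 y.2⟩)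
    (fun _ _ _ => Subtype.ext (add_mul _ _ _)) (fun _ _ _ => Subtype.ext (smul_mul_assoc _ _ _))
    (fun _ _ _ => Subtype.ext (mul_add _ _ _)) (fun _ _ _ => Subtype.ext (mul_smul_comm _ _ _))

/-- The multiplication `F_i / F_{< i} × F_j / F_{< j} → F_{i+j} / F_{< i+j}`. -/
def grMul (i j : ι) : GrPiece F i →ₗ[k] GrPiece F j →ₗ[k] GrPiece F (i + j) :=
  Submodule.liftQ _
    (LinearMap.flip (Submodule.liftQ _
      (LinearMap.flip ((filtrationMul F i j).compr₂ (grMk F (i + j))))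
      (fun y hy => by
        refine LinearMap.ext fun x => ?_
        exact (Submodule.Quotient.mk_eq_zero _).2 (mul_filtrationLT_mem F x.2 hy))))
    (fun x hx => by
      refine LinearMap.ext fun y => ?_
      obtain ⟨y, rfl⟩ := grMk_surjective F _ y
      exact (Submodule.Quotient.mk_eq_zero _).2 (filtrationLT_mul_mem F hx y.2))

instance : GradedMonoid.GMul (GrPiece F) := ⟨fun x y => grMul F _ _ x y⟩

instance : GradedMonoid.GOne (GrPiece F) := ⟨grMk F 0 ⟨1, SetLike.one_mem_graded F⟩⟩

theorem grMk_mul (i j : ι) (x : F i) (y : F j) :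
    GradedMonoid.GMul.mul (A := GrPiece F) (grMk F i x) (grMk F j y) =
      grMk F (i + j) ⟨x * y, SetLike.mul_mem_graded x.2 y.2⟩ := rfl

instance : DirectSum.GRing (GrPiece F) where
  mul_zero _ := map_zero _
  zero_mul _ := LinearMap.map_zero₂ _ _
  mul_add _ _ _ := map_add _ _ _
  add_mul _ _ _ := LinearMap.map_add₂ _ _ _ _
  one_mul := by
    rintro ⟨i, x⟩
    obtain ⟨x, rfl⟩ := grMk_surjective F _ x
    exact grMk_congr F (zero_add i) _ x (one_mul _)
  mul_one := by
    rintro ⟨i, x⟩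
    obtain ⟨x, rfl⟩ := grMk_surjective F _ x
    exact grMk_congr F (add_zero i) _ x (mul_one _)
  mul_assoc := by
    rintro ⟨i, x⟩ ⟨j, y⟩ ⟨l, z⟩
    obtain ⟨x, rfl⟩ := grMk_surjective F _ x
    obtain ⟨y, rfl⟩ := grMk_surjective F _ y
    obtain ⟨z, rfl⟩ := grMk_surjective F _ z
    exact grMk_congr F (add_assoc i j l) _ _ (mul_assoc _ _ _)
  natCast n := n • GradedMonoid.GOne.one
  natCast_zero := zero_smul _ _
  natCast_succ n := succ_nsmul _ _
  intCast n := n • GradedMonoid.GOne.one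
  intCast_ofNat n := natCast_zsmul _ _
  intCast_negSucc_ofNat n := negSucc_zsmul _ _

instance : DirectSum.GAlgebra k (GrPiece F) where
  toFun := (grMk F 0 ∘ₗ (Algebra.linearMap k A).codRestrict (F 0)
    (SetLike.algebraMap_mem_graded F)).toAddMonoidHom
  map_one := congrArg (grMk F 0) (Subtype.ext (map_one (algebraMap k A)))
  map_mul _ _ := grMk_congr F (add_zero 0).symm _ _ (map_mul (algebraMap k A) _ _)
  commutes := by
    rintro r ⟨i, x⟩
    obtain ⟨x, rfl⟩ := grMk_surjective F _ x
    exact grMk_congr F ((zero_add i).trans (add_zero i).symm) _ _ (Algebra.commutes r (x : A))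
  smul_def := by
    rintro r ⟨i, x⟩
    obtain ⟨x, rfl⟩ := grMk_surjective F _ x
    exact grMk_congr F (zero_add i).symm (r • x) _ (Algebra.smul_def r (x : A))

/-- The associated graded algebra `⨁ᵢ F_i / F_{< i}`. -/
abbrev AssocGraded : Type _ := ⨁ i, GrPiece F i

variable [DecidableEq ι]

/-- The symbol of `x ∈ F_i`, as an element of the associated graded algebra. -/
def grOf (i : ι) (x : F i) : AssocGraded F := DirectSum.of (GrPiece F) i (grMk F i x)

/-- The homogeneous component of degree `i` of the associated graded algebra. -/
def grComponent (i : ι) : Submodule k (AssocGraded F) :=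
  LinearMap.range (DirectSum.lof k ι (GrPiece F) i)

end AssociatedGraded
section Presented

universe u

variable {A : Type u} [Ring A] [Algebra ℂ A]

/-- The quotient of a `ℂ`-algebra by the two-sided ideal generated by the elements `x - y` for
`r x y`. -/
def Presented (r : A → A → Prop) : Type u := RingQuot r

variable (r : A → A → Prop)

instance : Ring (Presented r) := inferInstanceAs (Ring (RingQuot r))

instance : Algebra ℂ (Presented r) := inferInstanceAs (Algebra ℂ (RingQuot r))

/-- The quotient morphism. -/
def Presented.mk : A →ₐ[ℂ] Presented r := RingQuot.mkAlgHom ℂ r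

variable {r}

theorem Presented.mk_rel {x y : A} (h : r x y) : Presented.mk r x = Presented.mk r y :=
  RingQuot.mkAlgHom_rel ℂ h

theorem Presented.mk_surjective : Function.Surjective (Presented.mk r) :=
  RingQuot.mkAlgHom_surjective ℂ r

/-- The universal property of the quotient. -/
def Presented.lift {B : Type*} [Ring B] [Algebra ℂ B] (f : A →ₐ[ℂ] B)
    (h : ∀ ⦃x y⦄, r x y → f x = f y) : Presented r →ₐ[ℂ] B :=
  RingQuot.liftAlgHom ℂ ⟨f, h⟩

@[simp]
theorem Presented.lift_mk {B : Type*} [Ring B] [Algebra ℂ B] (f : A →ₐ[ℂ] B)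
    (h : ∀ ⦃x y⦄, r x y → f x = f y) (x : A) :
    Presented.lift f h (Presented.mk r x) = f x :=
  RingQuot.liftAlgHom_mkAlgHom_apply ℂ f h x

theorem Presented.hom_ext {B : Type*} [Semiring B] [Algebra ℂ B] {φ ψ : Presented r →ₐ[ℂ] B}
    (h : φ.comp (Presented.mk r) = ψ.comp (Presented.mk r)) : φ = ψ :=
  RingQuot.ringQuot_ext' _ _ _ h

end Presented

section QuantizedEnvelopingAlgebra

/-- Names for the generators `E`, `F`, `K`, `K⁻¹` of `U_q(𝔰𝔩₂)`. -/
inductive UqGen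
  | E | F | K | Kinv

/-- The defining relations of `U_q(𝔰𝔩₂)`. -/
inductive UqRel (q : ℂˣ) : FreeAlgebra ℂ UqGen → FreeAlgebra ℂ UqGen → Prop
  | K_Kinv : UqRel q (FreeAlgebra.ι ℂ .K * FreeAlgebra.ι ℂ .Kinv) 1
  | Kinv_K : UqRel q (FreeAlgebra.ι ℂ .Kinv * FreeAlgebra.ι ℂ .K) 1
  | K_E : UqRel q (FreeAlgebra.ι ℂ .K * FreeAlgebra.ι ℂ .E)
      ((q : ℂ) ^ 2 • (FreeAlgebra.ι ℂ .E * FreeAlgebra.ι ℂ .K))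
  | K_F : UqRel q (FreeAlgebra.ι ℂ .K * FreeAlgebra.ι ℂ .F)
      (((q : ℂ) ^ 2)⁻¹ • (FreeAlgebra.ι ℂ .F * FreeAlgebra.ι ℂ .K))
  | E_F : UqRel q
      (FreeAlgebra.ι ℂ .E * FreeAlgebra.ι ℂ .F - FreeAlgebra.ι ℂ .F * FreeAlgebra.ι ℂ .E)
      (((q : ℂ) - (q : ℂ)⁻¹)⁻¹ • (FreeAlgebra.ι ℂ .K - FreeAlgebra.ι ℂ .Kinv))

/-- The quantized enveloping algebra `U_q(𝔰𝔩₂)`. -/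
abbrev Uq (q : ℂˣ) : Type := Presented (UqRel q)

/-- The generators of `U_q(𝔰𝔩₂)`. -/
def Uq.gen (q : ℂˣ) (g : UqGen) : Uq q := Presented.mk (UqRel q) (FreeAlgebra.ι ℂ g)

variable (q : ℂˣ)

theorem Uq.K_Kinv : Uq.gen q .K * Uq.gen q .Kinv = 1 := by
  simpa [Uq.gen] using Presented.mk_rel (UqRel.K_Kinv (q := q))

theorem Uq.Kinv_K : Uq.gen q .Kinv * Uq.gen q .K = 1 := by
  simpa [Uq.gen] using Presented.mk_rel (UqRel.Kinv_K (q := q))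

theorem Uq.K_E : Uq.gen q .K * Uq.gen q .E = (q : ℂ) ^ 2 • (Uq.gen q .E * Uq.gen q .K) := by
  simpa [Uq.gen] using Presented.mk_rel (UqRel.K_E (q := q))

theorem Uq.K_F : Uq.gen q .K * Uq.gen q .F = ((q : ℂ) ^ 2)⁻¹ • (Uq.gen q .F * Uq.gen q .K) := by
  simpa [Uq.gen] using Presented.mk_rel (UqRel.K_F (q := q))

theorem Uq.E_F : Uq.gen q .E * Uq.gen q .F - Uq.gen q .F * Uq.gen q .E =
    ((q : ℂ) - (q : ℂ)⁻¹)⁻¹ • (Uq.gen q .K - Uq.gen q .Kinv) := by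
  simpa [Uq.gen] using Presented.mk_rel (UqRel.E_F (q := q))

variable {q} in
/-- The algebra morphism out of `U_q(𝔰𝔩₂)` with prescribed values on the generators. -/
def Uq.lift {B : Type*} [Ring B] [Algebra ℂ B] (f : UqGen → B)
    (h₁ : f .K * f .Kinv = 1) (h₂ : f .Kinv * f .K = 1)
    (h₃ : f .K * f .E = (q : ℂ) ^ 2 • (f .E * f .K))
    (h₄ : f .K * f .F = ((q : ℂ) ^ 2)⁻¹ • (f .F * f .K))
    (h₅ : f .E * f .F - f .F * f .E = ((q : ℂ) - (q : ℂ)⁻¹)⁻¹ • (f .K - f .Kinv)) :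
    Uq q →ₐ[ℂ] B :=
  Presented.lift (FreeAlgebra.lift ℂ f) (by
    rintro _ _ (_ | _ | _ | _ | _) <;> simpa)

variable {q} in
@[simp]
theorem Uq.lift_gen {B : Type*} [Ring B] [Algebra ℂ B] (f : UqGen → B) (h₁ h₂ h₃ h₄ h₅)
    (g : UqGen) : Uq.lift (q := q) f h₁ h₂ h₃ h₄ h₅ (Uq.gen q g) = f g := by
  simp [Uq.lift, Uq.gen]

variable {q} in
theorem Uq.algHom_ext {B : Type*} [Semiring B] [Algebra ℂ B] {φ ψ : Uq q →ₐ[ℂ] B}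
    (h : ∀ g, φ (Uq.gen q g) = ψ (Uq.gen q g)) : φ = ψ :=
  Presented.hom_ext (FreeAlgebra.hom_ext (funext h))

theorem Uq.Kinv_E : Uq.gen q .E * Uq.gen q .Kinv =
    (q : ℂ) ^ 2 • (Uq.gen q .Kinv * Uq.gen q .E) := by
  have h := congrArg (fun t => Uq.gen q .Kinv * t * Uq.gen q .Kinv) (Uq.K_E q)
  simp only [mul_smul_comm, smul_mul_assoc] at h
  rw [← mul_assoc, Uq.Kinv_K, one_mul, mul_assoc, mul_assoc, Uq.K_Kinv, mul_one] at h
  exact h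

/-- The comultiplication: `Δ(E) = E ⊗ 1 + K ⊗ E`, `Δ(F) = F ⊗ K⁻¹ + 1 ⊗ F`,
`Δ(K^{±1}) = K^{±1} ⊗ K^{±1}`. -/
def Uq.comulGen : UqGen → Uq q ⊗[ℂ] Uq q
  | .E => Uq.gen q .E ⊗ₜ 1 + Uq.gen q .K ⊗ₜ Uq.gen q .E
  | .F => Uq.gen q .F ⊗ₜ Uq.gen q .Kinv + 1 ⊗ₜ Uq.gen q .F
  | .K => Uq.gen q .K ⊗ₜ Uq.gen q .K
  | .Kinv => Uq.gen q .Kinv ⊗ₜ Uq.gen q .Kinv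

/-- The comultiplication of `U_q(𝔰𝔩₂)`. -/
def Uq.comul : Uq q →ₐ[ℂ] Uq q ⊗[ℂ] Uq q :=
  Uq.lift (Uq.comulGen q)
    (by simp [Uq.comulGen, Uq.K_Kinv, Algebra.TensorProduct.one_def])
    (by simp [Uq.comulGen, Uq.Kinv_K, Algebra.TensorProduct.one_def])
    (by simp [Uq.comulGen, mul_add, add_mul, Uq.K_E, TensorProduct.smul_tmul'])
    (by simp [Uq.comulGen, mul_add, add_mul, Uq.K_F, TensorProduct.smul_tmul',
          Uq.K_Kinv, Uq.Kinv_K])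
    (by
      have hq : (q : ℂ) ≠ 0 := q.ne_zero
      have hEF : Uq.gen q .E * Uq.gen q .F = Uq.gen q .F * Uq.gen q .E +
          ((q : ℂ) - (q : ℂ)⁻¹)⁻¹ • (Uq.gen q .K - Uq.gen q .Kinv) := by
        rw [← Uq.E_F]; abel
      simp only [Uq.comulGen, mul_add, add_mul, Algebra.TensorProduct.tmul_mul_tmul, one_mul,
        mul_one, Uq.K_F, Uq.Kinv_E, hEF]
      simp only [TensorProduct.add_tmul, TensorProduct.tmul_add, TensorProduct.sub_tmul,
        TensorProduct.tmul_sub, ← TensorProduct.smul_tmul', TensorProduct.tmul_smul, smul_sub,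
        smul_smul]
      rw [mul_inv_cancel₀ (pow_ne_zero 2 hq), one_smul]
      abel)

/-- The counit of `U_q(𝔰𝔩₂)`. -/
def Uq.counit : Uq q →ₐ[ℂ] ℂ :=
  Uq.lift (fun | .E => 0 | .F => 0 | .K => 1 | .Kinv => 1)
    (by simp) (by simp) (by simp) (by simp) (by simp)

instance : Bialgebra ℂ (Uq q) :=
  Bialgebra.ofAlgHom (Uq.comul q) (Uq.counit q)
    (Uq.algHom_ext fun g => by
      cases g <;> simp [Uq.comul, Uq.comulGen, TensorProduct.tmul_add, TensorProduct.add_tmul,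
        Algebra.TensorProduct.one_def, add_assoc])
    (Uq.algHom_ext fun g => by
      cases g <;> simp [Uq.comul, Uq.counit, Uq.comulGen])
    (Uq.algHom_ext fun g => by
      cases g <;> simp [Uq.comul, Uq.counit, Uq.comulGen])

/-- The quantum integer `[n] = (qⁿ - q⁻ⁿ) / (q - q⁻¹)`. -/
def qInt (n : ℤ) : ℂ := ((q : ℂ) ^ n - (q : ℂ) ^ (-n)) / ((q : ℂ) - (q : ℂ)⁻¹)

/-- The matrices of the generators on the simple module `V_m` with basis `v_0, …, v_m`:
`K v_j = q^{m-2j} v_j`, `E v_j = [m-j+1] v_{j-1}`, `F v_j = [j+1] v_{j+1}`. -/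
def irrepGen (m : ℕ) : UqGen → Matrix (Fin (m + 1)) (Fin (m + 1)) ℂ
  | .E => .of fun i j => if (j : ℕ) = i + 1 then qInt q (m - j + 1) else 0
  | .F => .of fun i j => if (i : ℕ) = j + 1 then qInt q (j + 1) else 0
  | .K => .diagonal fun j => (q : ℂ) ^ ((m : ℤ) - 2 * j)
  | .Kinv => .diagonal fun j => (q : ℂ) ^ (-((m : ℤ) - 2 * j))

theorem qInt_zero : qInt q 0 = 0 := by simp [qInt]

theorem qInt_identity (a b : ℤ) : qInt q (a + 1) * qInt q b - qInt q (b + 1) * qInt q a =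
    ((q : ℂ) - (q : ℂ)⁻¹)⁻¹ * ((q : ℂ) ^ (b - a) - (q : ℂ) ^ (-(b - a))) := by
  have hq : (q : ℂ) ≠ 0 := q.ne_zero
  by_cases h : (q : ℂ) - (q : ℂ)⁻¹ = 0
  · simp [qInt, h]
  · have h' : (q : ℂ) ^ 2 - 1 ≠ 0 := by
      intro h0; apply h; field_simp; simpa using h0
    simp only [qInt, neg_add, neg_sub, zpow_add₀ hq, zpow_sub₀ hq, zpow_neg, zpow_one]
    have ha : (q : ℂ) ^ a ≠ 0 := zpow_ne_zero _ hq
    have hb : (q : ℂ) ^ b ≠ 0 := zpow_ne_zero _ hq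
    field_simp
    ring

theorem irrep_E_F (m : ℕ) :
    irrepGen q m .E * irrepGen q m .F - irrepGen q m .F * irrepGen q m .E =
      ((q : ℂ) - (q : ℂ)⁻¹)⁻¹ • (irrepGen q m .K - irrepGen q m .Kinv) := by
  have hEF : irrepGen q m .E * irrepGen q m .F =
      .diagonal fun i => qInt q (i + 1) * qInt q (m - i) := by
    ext i j
    simp only [irrepGen, Matrix.mul_apply, Matrix.of_apply, Matrix.diagonal_apply, ite_mul,
      mul_ite, zero_mul, mul_zero]
    rcases Nat.lt_or_ge (i : ℕ) m with hi | hi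
    · rw [Finset.sum_eq_single (⟨i + 1, by omega⟩ : Fin (m + 1))]
      · by_cases h : i = j
        · subst h
          simp only [Nat.cast_add, Nat.cast_one, if_true]
          rw [mul_comm]
          congr 2
          ring
        · have : (i : ℕ) ≠ j := fun h' => h (Fin.ext h')
          simp [h, this]
      · intro l _ hl
        have : (l : ℕ) ≠ i + 1 := fun h' => hl (Fin.ext h')
        simp [this]
      · simp
    · have hi' : (i : ℕ) = m := by omega
      rw [Finset.sum_eq_zero]
      · simp [hi', qInt_zero]
      · intro l _
        have : (l : ℕ) ≠ i + 1 := by omega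
        simp [this]
  have hFE : irrepGen q m .F * irrepGen q m .E =
      .diagonal fun i => qInt q (m - i + 1) * qInt q i := by
    ext i j
    simp only [irrepGen, Matrix.mul_apply, Matrix.of_apply, Matrix.diagonal_apply, ite_mul,
      mul_ite, zero_mul, mul_zero]
    rcases Nat.eq_zero_or_pos (i : ℕ) with hi | hi
    · rw [Finset.sum_eq_zero]
      · simp [hi, qInt_zero]
      · intro l _
        have : (i : ℕ) ≠ l + 1 := by omega
        simp [this]
    · obtain ⟨r, hr⟩ : ∃ r, (i : ℕ) = r + 1 := ⟨i - 1, by omega⟩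
      rw [Finset.sum_eq_single (⟨r, by omega⟩ : Fin (m + 1))]
      · by_cases h : i = j
        · subst h
          simp [hr, mul_comm]
        · have : (j : ℕ) ≠ r + 1 := fun h' => h (Fin.ext (by omega))
          simp [h, this]
      · intro l _ hl
        have : (i : ℕ) ≠ l + 1 := fun h' => hl (Fin.ext (by simp; omega))
        simp [this]
      · simp
  rw [hEF, hFE]
  ext i j
  by_cases h : i = j
  · subst h
    simp only [Matrix.sub_apply, Matrix.diagonal_apply_eq, Matrix.smul_apply, irrepGen,
      smul_eq_mul]
    rw [qInt_identity]
    ring_nf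
  · simp [irrepGen, h]

/-- The simple `U_q(𝔰𝔩₂)`-module `V_m` of type 1 and highest weight `m` (so of dimension `m + 1`),
as a morphism from `U_q(𝔰𝔩₂)` to matrices. -/
def irrepMatrix (m : ℕ) : Uq q →ₐ[ℂ] Matrix (Fin (m + 1)) (Fin (m + 1)) ℂ :=
  Uq.lift (irrepGen q m)
    (by
      have hq : (q : ℂ) ≠ 0 := q.ne_zero
      simp [irrepGen, ← zpow_add₀ hq])
    (by
      have hq : (q : ℂ) ≠ 0 := q.ne_zero
      simp [irrepGen, ← zpow_add₀ hq])
    (by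
      have hq : (q : ℂ) ≠ 0 := q.ne_zero
      ext i j
      simp only [irrepGen, Matrix.diagonal_mul, Matrix.smul_apply, Matrix.mul_diagonal,
        Matrix.of_apply, smul_eq_mul]
      split_ifs with h
      · rw [h, mul_comm, mul_left_comm, ← zpow_natCast, ← zpow_add₀ hq]
        congr 2
        push_cast
        ring
      · simp)
    (by
      have hq : (q : ℂ) ≠ 0 := q.ne_zero
      ext i j
      simp only [irrepGen, Matrix.diagonal_mul, Matrix.smul_apply, Matrix.mul_diagonal,
        Matrix.of_apply, smul_eq_mul]
      split_ifs with h
      · rw [h, mul_comm, mul_left_comm, ← zpow_natCast, ← zpow_neg, ← zpow_add₀ hq]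
        congr 2
        push_cast
        ring
      · simp)
    (irrep_E_F q m)

/-- The action of `U_q(𝔰𝔩₂)` on `V_m = ℂ^{m+1}`. -/
def irrep (m : ℕ) : Uq q →ₐ[ℂ] Module.End ℂ (Fin (m + 1) → ℂ) :=
  (Matrix.toLinAlgEquiv' : Matrix (Fin (m + 1)) (Fin (m + 1)) ℂ ≃ₐ[ℂ] _).toAlgHom.comp
    (irrepMatrix q m)

/-- The linear dual `U_q(𝔰𝔩₂)^*` with the product dual to the comultiplication. The Hopf dual is a
subalgebra of it. -/
abbrev UqDual : Type := WithConv (Uq q →ₗ[ℂ] ℂ)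

/-- The matrix coefficient `c_{f,v} : u ↦ f(u v)` of a module `M`. -/
def matrixCoeff {q : ℂˣ} {M : Type*} [AddCommGroup M] [Module ℂ M]
    (ρ : Uq q →ₐ[ℂ] Module.End ℂ M) (f : Module.Dual ℂ M) (v : M) : UqDual q :=
  WithConv.toConv (f ∘ₗ LinearMap.applyₗ v ∘ₗ ρ.toLinearMap)

end QuantizedEnvelopingAlgebra
section QuantumMatrices

/-- Names for the generators `a`, `b`, `c`, `d` of `O_q(Mat₂)`. -/
inductive MatGen
  | a | b | c | d

/-- The defining relations of `O_q(Mat₂)`. -/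
inductive MatRel (q : ℂˣ) : FreeAlgebra ℂ MatGen → FreeAlgebra ℂ MatGen → Prop
  | a_b : MatRel q (FreeAlgebra.ι ℂ .a * FreeAlgebra.ι ℂ .b)
      ((q : ℂ) • (FreeAlgebra.ι ℂ .b * FreeAlgebra.ι ℂ .a))
  | a_c : MatRel q (FreeAlgebra.ι ℂ .a * FreeAlgebra.ι ℂ .c)
      ((q : ℂ) • (FreeAlgebra.ι ℂ .c * FreeAlgebra.ι ℂ .a))
  | b_c : MatRel q (FreeAlgebra.ι ℂ .b * FreeAlgebra.ι ℂ .c)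
      (FreeAlgebra.ι ℂ .c * FreeAlgebra.ι ℂ .b)
  | b_d : MatRel q (FreeAlgebra.ι ℂ .b * FreeAlgebra.ι ℂ .d)
      ((q : ℂ) • (FreeAlgebra.ι ℂ .d * FreeAlgebra.ι ℂ .b))
  | c_d : MatRel q (FreeAlgebra.ι ℂ .c * FreeAlgebra.ι ℂ .d)
      ((q : ℂ) • (FreeAlgebra.ι ℂ .d * FreeAlgebra.ι ℂ .c))
  | a_d : MatRel q
      (FreeAlgebra.ι ℂ .a * FreeAlgebra.ι ℂ .d - FreeAlgebra.ι ℂ .d * FreeAlgebra.ι ℂ .a)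
      (((q : ℂ) - (q : ℂ)⁻¹) • (FreeAlgebra.ι ℂ .b * FreeAlgebra.ι ℂ .c))

variable (q : ℂˣ)

/-- The quantum matrix algebra `O_q(Mat₂)`. -/
abbrev OqMat : Type := Presented (MatRel q)

/-- The generators of `O_q(Mat₂)`. -/
def OqMat.gen (g : MatGen) : OqMat q := Presented.mk (MatRel q) (FreeAlgebra.ι ℂ g)

/-- The quantum determinant `ad - qbc`. -/
def qDet : OqMat q :=
  OqMat.gen q .a * OqMat.gen q .d - (q : ℂ) • (OqMat.gen q .b * OqMat.gen q .c)

/-- The relation `D_q = t`. -/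
inductive FibreRel (t : ℂ) : OqMat q → OqMat q → Prop
  | det : FibreRel t (qDet q) (algebraMap ℂ (OqMat q) t)

/-- The quotient of `O_q(Mat₂)` by the two-sided ideal generated by `D_q - t`. -/
abbrev OqFibre (t : ℂ) : Type := Presented (FibreRel q t)

/-- The images of the generators `a`, `b`, `c`, `d` in the quotient. -/
def OqFibre.gen (t : ℂ) (g : MatGen) : OqFibre q t := Presented.mk (FibreRel q t) (OqMat.gen q g)

/-- `O_q(SL₂) = O_q(Mat₂) / ⟨D_q - 1⟩`. -/
abbrev OqSL2 : Type := OqFibre q 1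

/-- `O_q(Mat₂) / ⟨ad - qbc⟩`. -/
abbrev OqSing : Type := OqFibre q 0

/-- The component of degree `n` of the graded algebra `O_q(Mat₂) / ⟨ad - qbc⟩`: the span of the
products of `n` generators. -/
def OqSing.component (n : ℕ) : Submodule ℂ (OqSing q) :=
  Submodule.span ℂ (Set.range (OqFibre.gen q 0)) ^ n

end QuantumMatrices

section PeterWeyl

variable (q : ℂˣ)

/-- The matrix coefficient `u ↦ u_{ij}` of the two-dimensional module `V_1`. -/
def stdCoeff (i j : Fin 2) : UqDual q :=
  matrixCoeff (irrep q 1) (LinearMap.proj i) (Pi.single j 1)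

/-- The action of `U_q(𝔰𝔩₂)` on `V_1 ⊗ V_1`. -/
def stdTensor : Uq q →ₐ[ℂ] Module.End ℂ ((Fin 2 → ℂ) ⊗[ℂ] (Fin 2 → ℂ)) :=
  (Module.endTensorEndAlgHom (R := ℂ) (S := ℂ) (A := ℂ)).comp
    ((Algebra.TensorProduct.map (irrep q 1) (irrep q 1)).comp (Uq.comul q))

theorem Uq.induction {p : Uq q → Prop} (h₀ : ∀ r, p (algebraMap ℂ (Uq q) r))
    (h₁ : ∀ g, p (Uq.gen q g)) (h₂ : ∀ x y, p x → p y → p (x * y))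
    (h₃ : ∀ x y, p x → p y → p (x + y)) (u : Uq q) : p u := by
  obtain ⟨u, rfl⟩ := Presented.mk_surjective u
  induction u using FreeAlgebra.induction with
  | grade0 r => simpa using h₀ r
  | grade1 g => exact h₁ g
  | mul x y hx hy => simpa using h₂ _ _ hx hy
  | add x y hx hy => simpa using h₃ _ _ hx hy

theorem stdCoeff_mul_apply (i j k l : Fin 2) (u : Uq q) :
    (stdCoeff q i j * stdCoeff q k l) u =
      LinearMap.mul' ℂ ℂ (TensorProduct.map (LinearMap.proj i) (LinearMap.proj k)
        (stdTensor q u (Pi.single j 1 ⊗ₜ Pi.single l 1))) := by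
  rw [LinearMap.convMul_apply]
  change _ = LinearMap.mul' ℂ ℂ (TensorProduct.map (LinearMap.proj i) (LinearMap.proj k)
    (Module.endTensorEndAlgHom (R := ℂ) (S := ℂ) (A := ℂ)
      (Algebra.TensorProduct.map (irrep q 1) (irrep q 1) (Coalgebra.comul (R := ℂ) u)) _))
  generalize Coalgebra.comul (R := ℂ) u = t
  induction t with
  | zero => simp
  | add x y hx hy => simp only [map_add, hx, hy, LinearMap.add_apply]
  | tmul x y => simp [stdCoeff, matrixCoeff, Module.endTensorEndAlgHom_apply]

theorem irrep_one_gen_apply (g : UqGen) (j : Fin 2) :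
    irrep q 1 (Uq.gen q g) (Pi.single j 1) = fun i => irrepGen q 1 g i j := by
  simp only [irrep, irrepMatrix, AlgHom.comp_apply, Uq.lift_gen]
  exact Matrix.mulVec_single_one (irrepGen q 1 g) j

theorem irrep_one_E (j : Fin 2) : irrep q 1 (Uq.gen q .E) (Pi.single j 1) =
    if j = 0 then 0 else qInt q 1 • Pi.single 0 1 := by
  rw [irrep_one_gen_apply]
  ext i
  fin_cases i <;> fin_cases j <;> simp [irrepGen]

theorem irrep_one_F (j : Fin 2) : irrep q 1 (Uq.gen q .F) (Pi.single j 1) =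
    if j = 0 then qInt q 1 • Pi.single 1 1 else 0 := by
  rw [irrep_one_gen_apply]
  ext i
  fin_cases i <;> fin_cases j <;> simp [irrepGen]

theorem irrep_one_K (j : Fin 2) : irrep q 1 (Uq.gen q .K) (Pi.single j 1) =
    (if j = 0 then (q : ℂ) else (q : ℂ)⁻¹) • Pi.single j 1 := by
  rw [irrep_one_gen_apply]
  ext i
  fin_cases i <;> fin_cases j <;> norm_num [irrepGen]

theorem irrep_one_Kinv (j : Fin 2) : irrep q 1 (Uq.gen q .Kinv) (Pi.single j 1) =
    (if j = 0 then (q : ℂ)⁻¹ else (q : ℂ)) • Pi.single j 1 := by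
  rw [irrep_one_gen_apply]
  ext i
  fin_cases i <;> fin_cases j <;> norm_num [irrepGen]

/-- The tensor `v_i ⊗ v_j` of basis vectors of `V_1`. -/
def stdBasis (i j : Fin 2) : (Fin 2 → ℂ) ⊗[ℂ] (Fin 2 → ℂ) := Pi.single i 1 ⊗ₜ Pi.single j 1

theorem stdTensor_gen (g : UqGen) (i j : Fin 2) : stdTensor q (Uq.gen q g) (stdBasis i j) =
    (match g with
    | .E => (if i = 0 then 0 else qInt q 1 • stdBasis 0 j) +
        (if j = 0 then 0 else ((if i = 0 then (q : ℂ) else (q : ℂ)⁻¹) * qInt q 1) • stdBasis i 0)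
    | .F => (if i = 0 then (qInt q 1 * (if j = 0 then (q : ℂ)⁻¹ else (q : ℂ))) • stdBasis 1 j
          else 0) + (if j = 0 then qInt q 1 • stdBasis i 1 else 0)
    | .K => ((if i = 0 then (q : ℂ) else (q : ℂ)⁻¹) * (if j = 0 then (q : ℂ) else (q : ℂ)⁻¹)) •
        stdBasis i j
    | .Kinv => ((if i = 0 then (q : ℂ)⁻¹ else (q : ℂ)) * (if j = 0 then (q : ℂ)⁻¹ else (q : ℂ))) •
        stdBasis i j : (Fin 2 → ℂ) ⊗[ℂ] (Fin 2 → ℂ)) := by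
  cases g <;> fin_cases i <;> fin_cases j <;>
    simp [stdTensor, Uq.comul, Uq.comulGen, stdBasis, irrep_one_E, irrep_one_F,
      irrep_one_K, irrep_one_Kinv, TensorProduct.smul_tmul', TensorProduct.tmul_smul,
      Module.endTensorEndAlgHom_apply, smul_smul, mul_comm (qInt q 1)]

theorem stdTensor_invariant (u : Uq q) :
    stdTensor q u (stdBasis 0 1 - (q : ℂ) • stdBasis 1 0) =
      Uq.counit q u • (stdBasis 0 1 - (q : ℂ) • stdBasis 1 0) := by
  have hq : (q : ℂ) ≠ 0 := q.ne_zero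
  induction u using Uq.induction with
  | h₀ r => simp [Algebra.algebraMap_eq_smul_one]
  | h₁ g => 
    cases g <;> simp [stdTensor_gen, Uq.counit, smul_smul, hq, mul_comm (qInt q 1)]
  | h₂ x y hx hy => 
    rw [map_mul, Module.End.mul_apply, hy, map_smul, hx, smul_smul, map_mul, mul_comm]
  | h₃ x y hx hy => rw [map_add, LinearMap.add_apply, hx, hy, map_add, add_smul]

/-- The coordinate of `v_i ⊗ v_k` on `V_1 ⊗ V_1`. -/
def stdCoord (i k : Fin 2) : Module.Dual ℂ ((Fin 2 → ℂ) ⊗[ℂ] (Fin 2 → ℂ)) :=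
  LinearMap.mul' ℂ ℂ ∘ₗ TensorProduct.map (LinearMap.proj i) (LinearMap.proj k)

theorem stdCoord_stdBasis (i j k l : Fin 2) :
    stdCoord i k (stdBasis j l) = if i = j ∧ k = l then 1 else 0 := by
  by_cases h : i = j <;> by_cases h' : k = l <;> 
    simp [stdCoord, stdBasis, h, h']

theorem stdTensor_coinvariant (u : Uq q) (t : (Fin 2 → ℂ) ⊗[ℂ] (Fin 2 → ℂ)) :
    (stdCoord 0 1 - (q : ℂ) • stdCoord 1 0) (stdTensor q u t) =
      Uq.counit q u * (stdCoord 0 1 - (q : ℂ) • stdCoord 1 0) t := by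
  have hq : (q : ℂ) ≠ 0 := q.ne_zero
  induction u using Uq.induction generalizing t with
  | h₀ r => simp [Algebra.algebraMap_eq_smul_one]
  | h₁ g =>
    suffices h : (stdCoord 0 1 - (q : ℂ) • stdCoord 1 0) ∘ₗ stdTensor q (Uq.gen q g) =
        Uq.counit q (Uq.gen q g) • (stdCoord 0 1 - (q : ℂ) • stdCoord 1 0) from
      LinearMap.congr_fun h t
    refine ((Pi.basisFun ℂ (Fin 2)).tensorProduct (Pi.basisFun ℂ (Fin 2))).ext fun ⟨i, j⟩ => ?_
    rw [Module.Basis.tensorProduct_apply, Pi.basisFun_apply, Pi.basisFun_apply]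
    change ((stdCoord 0 1 - (q : ℂ) • stdCoord 1 0) ∘ₗ stdTensor q (Uq.gen q g)) (stdBasis i j) =
      (Uq.counit q (Uq.gen q g) • (stdCoord 0 1 - (q : ℂ) • stdCoord 1 0)) (stdBasis i j)
    rw [LinearMap.comp_apply, stdTensor_gen]
    cases g <;> fin_cases i <;> fin_cases j <;>
      simp [stdCoord_stdBasis, Uq.counit, hq, mul_comm (qInt q 1)]
  | h₂ x y hx hy => rw [map_mul, Module.End.mul_apply, hx, hy, map_mul, mul_assoc]
  | h₃ x y hx hy => rw [map_add, LinearMap.add_apply, map_add, hx, hy, map_add, add_mul]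

theorem stdCoeff_mul_apply' (i j k l : Fin 2) (u : Uq q) :
    (stdCoeff q i j * stdCoeff q k l) u = stdCoord i k (stdTensor q u (stdBasis j l)) :=
  stdCoeff_mul_apply q i j k l u

theorem stdCoeff_row (i k : Fin 2) :
    stdCoeff q i 0 * stdCoeff q k 1 - (q : ℂ) • (stdCoeff q i 1 * stdCoeff q k 0) =
      algebraMap ℂ (UqDual q) (stdCoord i k (stdBasis 0 1 - (q : ℂ) • stdBasis 1 0)) := by
  ext u
  have h := congrArg (stdCoord i k) (stdTensor_invariant q u)
  rw [map_sub, map_smul, map_sub, map_smul, map_smul, ← stdCoeff_mul_apply',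
    ← stdCoeff_mul_apply'] at h
  refine h.trans ?_
  rw [smul_eq_mul, mul_comm]
  rfl

theorem stdCoeff_col (j l : Fin 2) :
    stdCoeff q 0 j * stdCoeff q 1 l - (q : ℂ) • (stdCoeff q 1 j * stdCoeff q 0 l) =
      algebraMap ℂ (UqDual q) ((stdCoord 0 1 - (q : ℂ) • stdCoord 1 0) (stdBasis j l)) := by
  ext u
  have h := stdTensor_coinvariant q u (stdBasis j l)
  rw [LinearMap.sub_apply, LinearMap.smul_apply, ← stdCoeff_mul_apply',
    ← stdCoeff_mul_apply'] at h
  refine h.trans ?_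
  rw [mul_comm]
  rfl

/-- The assignment of `a`, `b`, `c`, `d` to the matrix coefficients of `V_1`. -/
def genCoeff : MatGen → UqDual q
  | .a => stdCoeff q 0 0
  | .b => stdCoeff q 0 1
  | .c => stdCoeff q 1 0
  | .d => stdCoeff q 1 1

theorem genCoeff_rel :
    genCoeff q .a * genCoeff q .b = (q : ℂ) • (genCoeff q .b * genCoeff q .a) ∧
    genCoeff q .a * genCoeff q .c = (q : ℂ) • (genCoeff q .c * genCoeff q .a) ∧
    genCoeff q .b * genCoeff q .c = genCoeff q .c * genCoeff q .b ∧
    genCoeff q .b * genCoeff q .d = (q : ℂ) • (genCoeff q .d * genCoeff q .b) ∧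
    genCoeff q .c * genCoeff q .d = (q : ℂ) • (genCoeff q .d * genCoeff q .c) ∧
    genCoeff q .a * genCoeff q .d - genCoeff q .d * genCoeff q .a =
      ((q : ℂ) - (q : ℂ)⁻¹) • (genCoeff q .b * genCoeff q .c) ∧
    genCoeff q .a * genCoeff q .d - (q : ℂ) • (genCoeff q .b * genCoeff q .c) = 1 := by
  have hq : (q : ℂ) ≠ 0 := q.ne_zero
  have r00 := stdCoeff_row q 0 0
  have r01 := stdCoeff_row q 0 1
  have r10 := stdCoeff_row q 1 0
  have r11 := stdCoeff_row q 1 1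
  have c00 := stdCoeff_col q 0 0
  have c10 := stdCoeff_col q 1 0
  have c11 := stdCoeff_col q 1 1
  simp only [map_sub, map_smul, stdCoord_stdBasis, LinearMap.sub_apply, LinearMap.smul_apply,
    smul_eq_mul] at r00 r01 r10 r11 c00 c10 c11
  norm_num at r00 r01 r10 r11 c00 c10 c11
  simp only [genCoeff]
  have hbc : stdCoeff q 0 1 * stdCoeff q 1 0 = stdCoeff q 1 0 * stdCoeff q 0 1 :=
    sub_left_injective (c10.trans r10.symm)
  have hda : stdCoeff q 1 1 * stdCoeff q 0 0 =
      1 + (q : ℂ)⁻¹ • (stdCoeff q 0 1 * stdCoeff q 1 0) := by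
    have h := congrArg ((q : ℂ)⁻¹ • ·) c10
    simp only [smul_sub, smul_smul, inv_mul_cancel₀ hq, one_smul, smul_neg] at h
    rw [Algebra.algebraMap_eq_smul_one, smul_smul, inv_mul_cancel₀ hq, one_smul] at h
    rw [sub_eq_iff_eq_add] at h
    rw [h]
    abel
  refine ⟨sub_eq_zero.1 r00, sub_eq_zero.1 c00, hbc, sub_eq_zero.1 c11, sub_eq_zero.1 r11, ?_,
    r01⟩
  rw [hda, sub_eq_iff_eq_add.1 r01, sub_smul]
  abel

/-- The morphism from `O_q(SL₂)` to the dual of `U_q(𝔰𝔩₂)` that sends the matrix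
`(a, b; c, d)` to the matrix coefficients of `V_1`. -/
def toUqDual : OqSL2 q →ₐ[ℂ] UqDual q :=
  Presented.lift
    (Presented.lift (FreeAlgebra.lift ℂ (genCoeff q)) (by
      obtain ⟨h₁, h₂, h₃, h₄, h₅, h₆, -⟩ := genCoeff_rel q
      rintro _ _ (_ | _ | _ | _ | _ | _) <;> simpa))
    (by
      rintro _ _ ⟨⟩
      obtain ⟨-, -, -, -, -, -, h⟩ := genCoeff_rel q
      simpa [qDet, OqMat.gen] using h)

theorem toUqDual_gen (g : MatGen) : toUqDual q (OqFibre.gen q 1 g) = genCoeff q g := by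
  simp [toUqDual, OqFibre.gen, OqMat.gen]

end PeterWeyl

section Filtration

/-- The weight lattice `ℤ` of `SL₂`, with the dominance order: `m ≤ n` if and only if `n - m` is a
nonnegative multiple of the simple root `2`. -/
def Weight : Type := ℤ

instance : CommRing Weight := inferInstanceAs (CommRing ℤ)

instance : DecidableEq Weight := inferInstanceAs (DecidableEq ℤ)

instance : PartialOrder Weight where
  le m n := ∃ r : ℕ, n = m + 2 * r
  le_refl m := ⟨0, by simp⟩
  le_trans l m n := by
    rintro ⟨r, rfl⟩ ⟨s, rfl⟩
    exact ⟨r + s, by push_cast; ring⟩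
  le_antisymm m n := by
    rintro ⟨r, hr⟩ ⟨s, hs⟩
    have hr' : @Eq ℤ n (@HAdd.hAdd ℤ ℤ ℤ _ m (2 * (r : ℤ))) := hr
    have hs' : @Eq ℤ m (@HAdd.hAdd ℤ ℤ ℤ _ n (2 * (s : ℤ))) := hs
    have h : @Eq ℤ m n := by omega
    exact h

instance : IsOrderedCancelAddMonoid Weight where
  add_le_add_left m n := by
    rintro ⟨r, rfl⟩ l
    exact ⟨r, by ring⟩
  le_of_add_le_add_left l m n := by
    rintro ⟨r, hr⟩
    exact ⟨r, add_left_cancel (hr.trans (add_assoc _ _ _))⟩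

variable (q : ℂˣ)

/-- The span, in the dual of `U_q(𝔰𝔩₂)`, of the matrix coefficients of the modules `V_m` with
`m ≤ n`. -/
def coeffSpan (n : Weight) : Submodule ℂ (UqDual q) :=
  Submodule.span ℂ
    {φ | ∃ m : ℕ, (m : Weight) ≤ n ∧ ∃ f v, φ = matrixCoeff (irrep q m) f v}

/-- The Peter–Weyl filtration: `O_q(SL₂)_{≤ n}` consists of the elements of `O_q(SL₂)` whose image
in the dual of `U_q(𝔰𝔩₂)` is a sum of matrix coefficients of modules `V_m` with `m ≤ n`. When
`O_q(SL₂)` is identified with the algebra of matrix coefficients through `toUqDual`, this is the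
image of the sum of the `V_m ⊗ V_m^*` with `m ≤ n`. -/
def peterWeyl (n : Weight) : Submodule ℂ (OqSL2 q) :=
  (coeffSpan q n).comap (toUqDual q).toLinearMap

theorem gen_mem_peterWeyl (g : MatGen) : OqFibre.gen q 1 g ∈ peterWeyl q 1 := by
  change toUqDual q (OqFibre.gen q 1 g) ∈ coeffSpan q 1
  rw [toUqDual_gen]
  refine Submodule.subset_span ⟨1, by simp, ?_⟩
  cases g <;> exact ⟨_, _, rfl⟩

end Filtration

section QuantumPlane

/-- The defining relation of the quantum plane, in the free algebra on `x = ι 0` and `y = ι 1`. -/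
inductive PlaneRel (q : ℂˣ) : FreeAlgebra ℂ (Fin 2) → FreeAlgebra ℂ (Fin 2) → Prop
  | x_y : PlaneRel q (FreeAlgebra.ι ℂ 0 * FreeAlgebra.ι ℂ 1)
      ((q : ℂ) • (FreeAlgebra.ι ℂ 1 * FreeAlgebra.ι ℂ 0))

variable (q : ℂˣ)

/-- The quantum plane `ℂ⟨x, y⟩ / ⟨xy - qyx⟩`. -/
abbrev Plane : Type := Presented (PlaneRel q)

/-- The generators `x` (index `0`) and `y` (index `1`) of the quantum plane. -/
def Plane.gen (i : Fin 2) : Plane q := Presented.mk (PlaneRel q) (FreeAlgebra.ι ℂ i)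

/-- `Sym_q^k(ℂ²)`, the component of degree `k` of the quantum plane: the span of the products of `k`
generators. -/
def symq (k : ℕ) : Submodule ℂ (Plane q) := Submodule.span ℂ (Set.range (Plane.gen q)) ^ k

instance : SetLike.GradedMonoid (symq q) :=
  Submodule.nat_power_gradedMonoid (Submodule.span ℂ (Set.range (Plane.gen q)))

/-- `Sym_q^k(ℂ²) ⊗ Sym_q^k(ℂ²)`, as a subspace of the tensor product of two quantum planes. -/
def segrePiece (k : ℕ) : Submodule ℂ (Plane q ⊗[ℂ] Plane q) :=
  LinearMap.range (TensorProduct.map (symq q k).subtype (symq q k).subtype)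

instance : SetLike.GradedMonoid (segrePiece q) where
  one_mem := ⟨⟨1, SetLike.one_mem_graded (symq q)⟩ ⊗ₜ ⟨1, SetLike.one_mem_graded (symq q)⟩, rfl⟩
  mul_mem := by
    rintro i j _ _ ⟨s, rfl⟩ ⟨t, rfl⟩
    induction s with
    | zero => simp
    | add s₁ s₂ h₁ h₂ => rw [map_add, add_mul]; exact add_mem h₁ h₂
    | tmul x y =>
      induction t with
      | zero => simp
      | add t₁ t₂ h₁ h₂ => rw [map_add, mul_add]; exact add_mem h₁ h₂
      | tmul z w =>
        exact ⟨⟨_, SetLike.mul_mem_graded x.2 z.2⟩ ⊗ₜ ⟨_, SetLike.mul_mem_graded y.2 w.2⟩, by simp⟩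

/-- The algebra `⨁_k Sym_q^k(ℂ²) ⊗ Sym_q^k(ℂ²)`, called `ℙ¹_q × ℙ¹_q`. -/
abbrev SegreAlg : Type := ⨁ k, segrePiece q k

/-- The component `Sym_q^k(ℂ²) ⊗ Sym_q^k(ℂ²)` of degree `k`. -/
def SegreAlg.component (k : ℕ) : Submodule ℂ (SegreAlg q) :=
  LinearMap.range (DirectSum.lof ℂ ℕ (fun k => segrePiece q k) k)

theorem gen_tmul_gen_mem (i j : Fin 2) : Plane.gen q i ⊗ₜ Plane.gen q j ∈ segrePiece q 1 := by
  have h : ∀ i, Plane.gen q i ∈ symq q 1 := fun i => by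
    rw [symq, pow_one]
    exact Submodule.subset_span ⟨i, rfl⟩
  exact ⟨⟨_, h i⟩ ⊗ₜ ⟨_, h j⟩, rfl⟩

/-- The element of degree one given by the tensor product of the `i`-th coordinate of the first
quantum plane and the `j`-th coordinate of the second. -/
def SegreAlg.gen (i j : Fin 2) : SegreAlg q :=
  DirectSum.of (fun k => segrePiece q k) 1 ⟨Plane.gen q i ⊗ₜ Plane.gen q j, gen_tmul_gen_mem q i j⟩

end QuantumPlane

end QuantumSL2

end

/-! Both isomorphisms come from the same dimension count. Call `OqSing q` the singular algebra,
where `ad = q bc`. Graded morphisms out of it are defined on generators, shown to be surjective in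
each degree, and then shown to be injective there because the source component has dimension at most
`(n+1)²` while the target component has dimension at least `(n+1)²` (`bijective_of_graded`).

Upper bound. In the singular algebra both `ad` and `da` are multiples of `bc`, so degree `n` is
spanned by monomials `b^j c^k a^i d^l` with `i = 0` or `l = 0`. These are indexed by the pairs
`(j+i, k+i)` in `{0,…,n}²` (`OqSing.component_le_span_range`).

The map to `gr`. The relations of `O_q(Mat₂)` are homogeneous and pass to symbols; `ad - q bc = 1`
has filtration degree 0, so its symbol in degree 2 is zero. This gives `toGr`. Products of matrix
coefficients are coefficients of tensor products, and Clebsch–Gordan, `V_{m+1} ⊗ V_1 = V_{m+2} ⊕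
V_m`, together with the determinant relation, identifies the span of coefficients of the `V_m`, `m ≤
n`, with the `n`-th power of the span for `V_1` (`coeffSpan_natCast`). This yields multiplicativity
of the filtration and also surjectivity of `toGr` in each degree. The lower bound on `gr` is the
independence of all matrix coefficients `u_{ij}` of all `V_m` (`linearIndependent_irrepCoeff`): they
are joint eigenvectors, with distinct eigenvalues, of translation by a Casimir element and of left
and right translation by `K`. The assumption on `q` makes the nonzero quantum integers invertible
and these eigenvalues distinct.

Injectivity of `toUqDual` is not needed: its kernel lies in every step of the filtration, hence in
every `F_{<n}`, and disappears in `gr` (`mem_filtrationLT_of_toUqDual_eq_zero`).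

The Segre side. The quantum plane has basis `y^j x^i`, so `Sym_q^n` has dimension at least `n+1`.
Equal degrees in the two tensor factors allow every element of degree `n` to be written through
products of degree 1 elements. -/

noncomputable section

namespace QuantumSL2

/-! ### Representations of `U_q(𝔰𝔩₂)`, tensor products and spaces of matrix coefficients -/

section Representations

variable {q : ℂˣ}

/-- The basis vector `v_j` of `V_m`, with `v_j = 0` for `j > m`. -/
def irrepVec (m j : ℕ) : Fin (m + 1) → ℂ := fun i => if (i : ℕ) = j then 1 else 0

theorem irrepVec_fin {m : ℕ} (j : Fin (m + 1)) : irrepVec m j = Pi.single j 1 := by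
  ext i
  simp [irrepVec, Pi.single_apply, Fin.ext_iff]

theorem irrepVec_eq_zero {m j : ℕ} (h : m < j) : irrepVec m j = 0 := by
  ext i
  have : (i : ℕ) ≠ j := by omega
  simp [irrepVec, this]

theorem irrep_apply (m : ℕ) (u : Uq q) (v : Fin (m + 1) → ℂ) :
    irrep q m u v = (irrepMatrix q m u).mulVec v := rfl

theorem irrep_gen_apply (m : ℕ) (g : UqGen) (j : Fin (m + 1)) :
    irrep q m (Uq.gen q g) (irrepVec m j) = fun i => irrepGen q m g i j := by
  rw [irrep_apply, irrepMatrix, Uq.lift_gen, irrepVec_fin]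
  exact Matrix.mulVec_single_one (irrepGen q m g) j

/-- Like the formulas for `E` and `K^{±1}` below, this is valid for every natural `j`, thanks to the
convention `v_j = 0` for `j > m`. At `j = m` the right side vanishes because `v_{m+1} = 0`. -/
theorem irrep_F (m j : ℕ) : irrep q m (Uq.gen q .F) (irrepVec m j) =
    qInt q (j + 1) • irrepVec m (j + 1) := by
  rcases Nat.lt_or_ge m j with h | h
  · rw [irrepVec_eq_zero h, irrepVec_eq_zero (by omega), map_zero, smul_zero]
  · refine (irrep_gen_apply m .F ⟨j, by omega⟩).trans ?_
    ext i
    simp [irrepGen, irrepVec]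

theorem irrep_E_zero (m : ℕ) : irrep q m (Uq.gen q .E) (irrepVec m 0) = 0 := by
  refine (irrep_gen_apply m .E ⟨0, by omega⟩).trans ?_
  ext i
  simp [irrepGen]

theorem irrep_E_succ (m j : ℕ) : irrep q m (Uq.gen q .E) (irrepVec m (j + 1)) =
    qInt q (m - j) • irrepVec m j := by
  rcases Nat.lt_or_ge m (j + 1) with h | h
  · rw [irrepVec_eq_zero h, map_zero]
    rcases Nat.lt_or_ge m j with h' | h'
    · rw [irrepVec_eq_zero h', smul_zero]
    -- Here `v_m` is not zero; the coefficient `[m - m] = 0` is what kills the right side.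
    · obtain rfl : j = m := by omega
      simp [qInt_zero]
  · refine (irrep_gen_apply m .E ⟨j + 1, by omega⟩).trans ?_
    ext i
    have : (m : ℤ) - (j + 1) + 1 = m - j := by ring
    simp [irrepGen, irrepVec, this, eq_comm]

theorem irrep_K (m j : ℕ) : irrep q m (Uq.gen q .K) (irrepVec m j) =
    (q : ℂ) ^ ((m : ℤ) - 2 * j) • irrepVec m j := by
  rcases Nat.lt_or_ge m j with h | h
  · rw [irrepVec_eq_zero h, map_zero, smul_zero]
  · refine (irrep_gen_apply m .K ⟨j, by omega⟩).trans ?_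
    ext i
    by_cases hi : (i : ℕ) = j <;> simp [irrepGen, irrepVec, Matrix.diagonal_apply, Fin.ext_iff, hi]

theorem irrep_Kinv (m j : ℕ) : irrep q m (Uq.gen q .Kinv) (irrepVec m j) =
    (q : ℂ) ^ (-((m : ℤ) - 2 * j)) • irrepVec m j := by
  rcases Nat.lt_or_ge m j with h | h
  · rw [irrepVec_eq_zero h, map_zero, smul_zero]
  · refine (irrep_gen_apply m .Kinv ⟨j, by omega⟩).trans ?_
    ext i
    by_cases hi : (i : ℕ) = j <;> simp [irrepGen, irrepVec, Matrix.diagonal_apply, Fin.ext_iff, hi]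

/-- On a one-dimensional space of weight 0 the operators `E` and `F` vanish and `K` is the identity,
as for the counit. Hence the coefficients of `V_0` are the scalars of the convolution algebra. -/
theorem irrep_zero_apply (u : Uq q) (v : Fin 1 → ℂ) : irrep q 0 u v = Uq.counit q u • v := by
  induction u using Uq.induction generalizing v with
  | h₀ r => simp [Algebra.algebraMap_eq_smul_one]
  | h₁ g =>
    obtain ⟨r, rfl⟩ : ∃ r : ℂ, v = r • irrepVec 0 0 := by
      refine ⟨v 0, ?_⟩
      ext i
      simp [irrepVec, Subsingleton.elim i 0]
    rw [map_smul]
    cases g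
    · rw [irrep_E_zero]; simp [Uq.counit]
    · rw [irrep_F, irrepVec_eq_zero (by omega)]; simp [Uq.counit]
    · rw [irrep_K]; simp [Uq.counit]
    · rw [irrep_Kinv]; simp [Uq.counit]
  | h₂ x y hx hy => rw [map_mul, Module.End.mul_apply, hy, hx, smul_smul, map_mul]
  | h₃ x y hx hy => rw [map_add, LinearMap.add_apply, hx, hy, map_add, add_smul]

variable {M N L : Type*} [AddCommGroup M] [Module ℂ M] [AddCommGroup N] [Module ℂ N]
  [AddCommGroup L] [Module ℂ L]

/-- The tensor product of two representations of `U_q(𝔰𝔩₂)`. -/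
def tensorRep (ρ : Uq q →ₐ[ℂ] Module.End ℂ M) (σ : Uq q →ₐ[ℂ] Module.End ℂ N) :
    Uq q →ₐ[ℂ] Module.End ℂ (M ⊗[ℂ] N) :=
  (Module.endTensorEndAlgHom (R := ℂ) (S := ℂ) (A := ℂ)).comp
    ((Algebra.TensorProduct.map ρ σ).comp (Uq.comul q))

section

variable (ρ : Uq q →ₐ[ℂ] Module.End ℂ M) (σ : Uq q →ₐ[ℂ] Module.End ℂ N) (v : M) (w : N)

theorem tensorRep_E : tensorRep ρ σ (Uq.gen q .E) (v ⊗ₜ w) =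
    ρ (Uq.gen q .E) v ⊗ₜ w + ρ (Uq.gen q .K) v ⊗ₜ σ (Uq.gen q .E) w := by
  simp [tensorRep, Uq.comul, Uq.comulGen, Module.endTensorEndAlgHom_apply]

theorem tensorRep_F : tensorRep ρ σ (Uq.gen q .F) (v ⊗ₜ w) =
    ρ (Uq.gen q .F) v ⊗ₜ σ (Uq.gen q .Kinv) w + v ⊗ₜ σ (Uq.gen q .F) w := by
  simp [tensorRep, Uq.comul, Uq.comulGen, Module.endTensorEndAlgHom_apply]

theorem tensorRep_K : tensorRep ρ σ (Uq.gen q .K) (v ⊗ₜ w) =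
    ρ (Uq.gen q .K) v ⊗ₜ σ (Uq.gen q .K) w := by
  simp [tensorRep, Uq.comul, Uq.comulGen, Module.endTensorEndAlgHom_apply]

theorem tensorRep_Kinv : tensorRep ρ σ (Uq.gen q .Kinv) (v ⊗ₜ w) =
    ρ (Uq.gen q .Kinv) v ⊗ₜ σ (Uq.gen q .Kinv) w := by
  simp [tensorRep, Uq.comul, Uq.comulGen, Module.endTensorEndAlgHom_apply]

/-- Convolution evaluates the two coefficients on `Δ(u)`, and `Δ(u)` is also what acts on the tensor
product. Once `Δ(u)` is replaced by an arbitrary tensor, pure tensors suffice. -/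
theorem matrixCoeff_mul (f : Module.Dual ℂ M) (g : Module.Dual ℂ N) :
    matrixCoeff ρ f v * matrixCoeff σ g w =
      matrixCoeff (tensorRep ρ σ) (TensorProduct.dualDistrib ℂ M N (f ⊗ₜ g)) (v ⊗ₜ w) := by
  ext u
  rw [LinearMap.convMul_apply]
  change _ = TensorProduct.dualDistrib ℂ M N (f ⊗ₜ g)
    (Module.endTensorEndAlgHom (R := ℂ) (S := ℂ) (A := ℂ)
      (Algebra.TensorProduct.map ρ σ (Coalgebra.comul (R := ℂ) u)) _)
  generalize Coalgebra.comul (R := ℂ) u = t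
  induction t with
  | zero => simp
  | add x y hx hy => simp only [map_add, hx, hy, LinearMap.add_apply]
  | tmul x y => simp [matrixCoeff, Module.endTensorEndAlgHom_apply]

end

/-- The span of the matrix coefficients of a representation. -/
def coeffSpace (ρ : Uq q →ₐ[ℂ] Module.End ℂ M) : Submodule ℂ (UqDual q) :=
  Submodule.span ℂ {φ | ∃ f v, φ = matrixCoeff ρ f v}

theorem matrixCoeff_mem (ρ : Uq q →ₐ[ℂ] Module.End ℂ M) (f : Module.Dual ℂ M) (v : M) :
    matrixCoeff ρ f v ∈ coeffSpace ρ :=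
  Submodule.subset_span ⟨f, v, rfl⟩

theorem matrixCoeff_add_left (ρ : Uq q →ₐ[ℂ] Module.End ℂ M) (f g : Module.Dual ℂ M) (v : M) :
    matrixCoeff ρ (f + g) v = matrixCoeff ρ f v + matrixCoeff ρ g v := rfl

theorem matrixCoeff_add_right (ρ : Uq q →ₐ[ℂ] Module.End ℂ M) (f : Module.Dual ℂ M) (v w : M) :
    matrixCoeff ρ f (v + w) = matrixCoeff ρ f v + matrixCoeff ρ f w := by
  ext u
  simp [matrixCoeff]

theorem matrixCoeff_zero_right (ρ : Uq q →ₐ[ℂ] Module.End ℂ M) (f : Module.Dual ℂ M) :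
    matrixCoeff ρ f 0 = 0 := by
  ext u
  simp [matrixCoeff]

theorem matrixCoeff_zero_left (ρ : Uq q →ₐ[ℂ] Module.End ℂ M) (v : M) :
    matrixCoeff ρ 0 v = 0 := rfl

/-- Finite dimension is what gives equality: every functional on `M ⊗ N` is then a sum of
functionals `f ⊗ g`. -/
theorem coeffSpace_mul [Module.Finite ℂ M] [Module.Finite ℂ N] (ρ : Uq q →ₐ[ℂ] Module.End ℂ M)
    (σ : Uq q →ₐ[ℂ] Module.End ℂ N) :
    coeffSpace ρ * coeffSpace σ = coeffSpace (tensorRep ρ σ) := by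
  refine le_antisymm ?_ (Submodule.span_le.2 ?_)
  · rw [coeffSpace, coeffSpace, Submodule.span_mul_span, Submodule.span_le]
    rintro _ ⟨_, ⟨f, v, rfl⟩, _, ⟨g, w, rfl⟩, rfl⟩
    simp only [matrixCoeff_mul]
    exact matrixCoeff_mem _ _ _
  · rintro _ ⟨f, x, rfl⟩
    obtain ⟨t, rfl⟩ := (TensorProduct.dualDistribEquiv ℂ M N).surjective f
    change matrixCoeff _ (TensorProduct.dualDistrib ℂ M N t) x ∈ _
    induction t with
    | zero => rw [map_zero, matrixCoeff_zero_left]; exact zero_mem _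
    | add t₁ t₂ h₁ h₂ => rw [map_add, matrixCoeff_add_left]; exact add_mem h₁ h₂
    | tmul f g =>
      induction x with
      | zero => rw [matrixCoeff_zero_right]; exact zero_mem _
      | add x₁ x₂ h₁ h₂ => rw [matrixCoeff_add_right]; exact add_mem h₁ h₂
      | tmul v w =>
        rw [← matrixCoeff_mul]
        exact Submodule.mul_mem_mul (matrixCoeff_mem _ _ _) (matrixCoeff_mem _ _ _)

/-- A linear map commuting with the action of `U_q(𝔰𝔩₂)`. -/
def IsIntertwiner (ρ : Uq q →ₐ[ℂ] Module.End ℂ M) (σ : Uq q →ₐ[ℂ] Module.End ℂ N)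
    (T : M →ₗ[ℂ] N) : Prop :=
  ∀ u v, T (ρ u v) = σ u (T v)

theorem IsIntertwiner.of_gen {ρ : Uq q →ₐ[ℂ] Module.End ℂ M} {σ : Uq q →ₐ[ℂ] Module.End ℂ N}
    {T : M →ₗ[ℂ] N} (h : ∀ g, T ∘ₗ ρ (Uq.gen q g) = σ (Uq.gen q g) ∘ₗ T) :
    IsIntertwiner ρ σ T := by
  intro u v
  induction u using Uq.induction generalizing v with
  | h₀ r => simp [Algebra.algebraMap_eq_smul_one]
  | h₁ g => exact LinearMap.congr_fun (h g) v
  | h₂ x y hx hy => rw [map_mul, map_mul, Module.End.mul_apply, Module.End.mul_apply, hx, hy]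
  | h₃ x y hx hy =>
    rw [map_add, map_add, LinearMap.add_apply, LinearMap.add_apply, map_add, hx, hy]

theorem IsIntertwiner.matrixCoeff {ρ : Uq q →ₐ[ℂ] Module.End ℂ M}
    {σ : Uq q →ₐ[ℂ] Module.End ℂ N} {T : M →ₗ[ℂ] N} (h : IsIntertwiner ρ σ T)
    (f : Module.Dual ℂ N) (v : M) :
    matrixCoeff σ f (T v) = matrixCoeff ρ (f ∘ₗ T) v := by
  ext u
  exact congrArg f (h u v).symm

/-- Functionals on a submodule extend to the ambient module, here by composing with a linear left
inverse of `T`, which need not commute with the action. -/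
theorem IsIntertwiner.coeffSpace_le {ρ : Uq q →ₐ[ℂ] Module.End ℂ M}
    {σ : Uq q →ₐ[ℂ] Module.End ℂ N} {T : M →ₗ[ℂ] N} (h : IsIntertwiner ρ σ T)
    (hT : Function.Injective T) : coeffSpace ρ ≤ coeffSpace σ := by
  refine Submodule.span_le.2 ?_
  rintro _ ⟨f, v, rfl⟩
  obtain ⟨S, hS⟩ := LinearMap.exists_leftInverse_of_injective T (LinearMap.ker_eq_bot.2 hT)
  have : f = (f ∘ₗ S) ∘ₗ T := by rw [LinearMap.comp_assoc, hS, LinearMap.comp_id]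
  rw [this, ← h.matrixCoeff]
  exact matrixCoeff_mem _ _ _

theorem IsIntertwiner.coeffSpace_le_sup {ρ : Uq q →ₐ[ℂ] Module.End ℂ M}
    {σ : Uq q →ₐ[ℂ] Module.End ℂ N} {τ : Uq q →ₐ[ℂ] Module.End ℂ L} {S : M →ₗ[ℂ] L}
    {T : N →ₗ[ℂ] L} (hS : IsIntertwiner ρ τ S) (hT : IsIntertwiner σ τ T)
    (h : Function.Surjective (S.coprod T)) : coeffSpace τ ≤ coeffSpace ρ ⊔ coeffSpace σ := by
  refine Submodule.span_le.2 ?_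
  rintro _ ⟨f, v, rfl⟩
  obtain ⟨⟨x, y⟩, rfl⟩ := h v
  rw [LinearMap.coprod_apply, matrixCoeff_add_right, hS.matrixCoeff, hT.matrixCoeff]
  exact Submodule.add_mem_sup (matrixCoeff_mem _ _ _) (matrixCoeff_mem _ _ _)

end Representations

/-! ### Quantum integers and the decomposition `V_{m+1} ⊗ V_1 = V_{m+2} ⊕ V_m` -/

section ClebschGordan

variable {q : ℂˣ}

theorem sub_inv_ne_zero (hq : ∀ n : ℕ, 0 < n → q ^ n ≠ 1) : (q : ℂ) - (q : ℂ)⁻¹ ≠ 0 := by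
  intro h
  refine hq 2 two_pos (Units.ext ?_)
  have h' : (q : ℂ) = (q : ℂ)⁻¹ := sub_eq_zero.1 h
  have hq0 : (q : ℂ) ≠ 0 := q.ne_zero
  rw [Units.val_pow_eq_pow_val, Units.val_one, pow_two]
  nth_rewrite 2 [h']
  exact mul_inv_cancel₀ hq0

theorem zpow_ne_one (hq : ∀ n : ℕ, 0 < n → q ^ n ≠ 1) {n : ℤ} (hn : n ≠ 0) :
    (q : ℂ) ^ n ≠ 1 := by
  intro h
  have h' : q ^ n = 1 := Units.ext (by simpa using h)
  refine hq n.natAbs (Int.natAbs_pos.2 hn) ?_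
  rcases Int.natAbs_eq n with h₁ | h₁ <;> rw [h₁] at h'
  · exact_mod_cast h'
  · rw [zpow_neg, inv_eq_one] at h'
    exact_mod_cast h'

theorem zpow_injective (hq : ∀ n : ℕ, 0 < n → q ^ n ≠ 1) {m n : ℤ}
    (h : (q : ℂ) ^ m = (q : ℂ) ^ n) : m = n := by
  by_contra hmn
  refine zpow_ne_one hq (sub_ne_zero.2 hmn) ?_
  rw [zpow_sub₀ q.ne_zero, h, div_self (zpow_ne_zero _ q.ne_zero)]

theorem qInt_one (hq : (q : ℂ) - (q : ℂ)⁻¹ ≠ 0) : qInt q 1 = 1 := by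
  simp [qInt, div_self hq]

theorem qInt_ne_zero (hq : ∀ n : ℕ, 0 < n → q ^ n ≠ 1) {n : ℤ} (hn : n ≠ 0) :
    qInt q n ≠ 0 := by
  refine div_ne_zero (fun h => hn ?_) (sub_inv_ne_zero hq)
  have := zpow_injective hq (sub_eq_zero.1 h)
  omega

/-- This asymmetric addition formula is the only identity between quantum integers that the
Clebsch–Gordan computations need: the factors `q^{-b}` and `q^a` are those produced by `K^{±1}` in
`Δ(E)` and `Δ(F)`. -/
theorem qInt_add (a b : ℤ) :
    qInt q (a + b) = ((q : ℂ) ^ b)⁻¹ * qInt q a + (q : ℂ) ^ a * qInt q b := by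
  have hq0 : (q : ℂ) ≠ 0 := q.ne_zero
  simp only [qInt, neg_add, zpow_add₀ hq0, zpow_neg]
  ring

theorem irrep_hom_ext {M : Type*} [AddCommGroup M] [Module ℂ M] {m : ℕ}
    {S T : (Fin (m + 1) → ℂ) →ₗ[ℂ] M} (h : ∀ j, S (irrepVec m j) = T (irrepVec m j)) : S = T := by
  refine (Pi.basisFun ℂ (Fin (m + 1))).ext fun j => ?_
  rw [Pi.basisFun_apply, ← irrepVec_fin]
  exact h j

/-- The linear map out of `V_m` with prescribed values on the basis. -/
def irrepLift {M : Type*} [AddCommGroup M] [Module ℂ M] (m : ℕ) (f : ℕ → M) :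
    (Fin (m + 1) → ℂ) →ₗ[ℂ] M :=
  (Pi.basisFun ℂ (Fin (m + 1))).constr ℂ fun j => f j

theorem irrepLift_apply {M : Type*} [AddCommGroup M] [Module ℂ M] {m : ℕ} {f : ℕ → M}
    (hf : ∀ j, m < j → f j = 0) (j : ℕ) : irrepLift m f (irrepVec m j) = f j := by
  rcases Nat.lt_or_ge m j with h | h
  · rw [irrepVec_eq_zero h, map_zero, hf j h]
  · have h' := (Pi.basisFun ℂ (Fin (m + 1))).constr_basis ℂ (fun j => f j) ⟨j, by omega⟩
    rwa [Pi.basisFun_apply, ← irrepVec_fin] at h'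

variable (q) in
/-- The embedding of `V_{m+1}` into `V_m ⊗ V_1`. -/
def cgTop (m : ℕ) : (Fin (m + 1 + 1) → ℂ) →ₗ[ℂ] (Fin (m + 1) → ℂ) ⊗[ℂ] (Fin (1 + 1) → ℂ) :=
  irrepLift (m + 1) fun
    | 0 => irrepVec m 0 ⊗ₜ irrepVec 1 0
    -- This is the divided power of `F` of order `j + 1` applied to `v_0 ⊗ v_0`; only two terms
    -- occur because `F²` is zero on `V_1`.
    | j + 1 => ((q : ℂ) ^ (j + 1))⁻¹ • irrepVec m (j + 1) ⊗ₜ irrepVec 1 0 +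
        irrepVec m j ⊗ₜ irrepVec 1 1

theorem cgTop_zero (m : ℕ) :
    cgTop q m (irrepVec (m + 1) 0) = irrepVec m 0 ⊗ₜ irrepVec 1 0 := by
  rw [cgTop, irrepLift_apply]
  rintro (_ | j) h
  · omega
  · simp [irrepVec_eq_zero (m := m) (j := j) (by omega),
      irrepVec_eq_zero (m := m) (j := j + 1) (by omega)]

theorem cgTop_succ (m j : ℕ) :
    cgTop q m (irrepVec (m + 1) (j + 1)) =
      ((q : ℂ) ^ (j + 1))⁻¹ • irrepVec m (j + 1) ⊗ₜ irrepVec 1 0 +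
        irrepVec m j ⊗ₜ irrepVec 1 1 := by
  rw [cgTop, irrepLift_apply]
  rintro (_ | j) h
  · omega
  · simp [irrepVec_eq_zero (m := m) (j := j) (by omega),
      irrepVec_eq_zero (m := m) (j := j + 1) (by omega)]

variable (q) in
/-- The embedding of `V_m` into `V_{m+1} ⊗ V_1`. -/
def cgBot (m : ℕ) : (Fin (m + 1) → ℂ) →ₗ[ℂ] (Fin (m + 1 + 1) → ℂ) ⊗[ℂ] (Fin (1 + 1) → ℂ) :=
  irrepLift m fun j =>
    -- At `j = 0` this is the vector of weight `m` in `V_{m+1} ⊗ V_1` annihilated by `E`; the other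
    -- values follow by applying divided powers of `F`.
    ((q : ℂ) ^ ((m : ℤ) + 1 - j) * qInt q (j + 1)) • irrepVec (m + 1) (j + 1) ⊗ₜ irrepVec 1 0 -
      qInt q (m + 1 - j) • irrepVec (m + 1) j ⊗ₜ irrepVec 1 1

theorem cgBot_apply (m j : ℕ) : cgBot q m (irrepVec m j) =
    ((q : ℂ) ^ ((m : ℤ) + 1 - j) * qInt q (j + 1)) • irrepVec (m + 1) (j + 1) ⊗ₜ irrepVec 1 0 -
      qInt q (m + 1 - j) • irrepVec (m + 1) j ⊗ₜ irrepVec 1 1 := by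
  rw [cgBot, irrepLift_apply]
  intro j h
  rw [irrepVec_eq_zero (m := m + 1) (j := j + 1) (by omega)]
  rcases Nat.lt_or_ge (m + 1) j with h' | h'
  · simp [irrepVec_eq_zero h']
  -- The boundary case: `v_{m+1}` is a nonzero vector of `V_{m+1}`, but its coefficient is `[0]`.
  · obtain rfl : j = m + 1 := by omega
    simp [qInt_zero]

theorem irrep_one_E_one (hq : (q : ℂ) - (q : ℂ)⁻¹ ≠ 0) :
    irrep q 1 (Uq.gen q .E) (irrepVec 1 1) = irrepVec 1 0 := by
  have := irrep_E_succ (q := q) 1 0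
  simpa [qInt_one hq] using this

theorem irrep_one_E_zero : irrep q 1 (Uq.gen q .E) (irrepVec 1 0) = 0 :=
  irrep_E_zero 1

theorem irrep_one_F_zero (hq : (q : ℂ) - (q : ℂ)⁻¹ ≠ 0) :
    irrep q 1 (Uq.gen q .F) (irrepVec 1 0) = irrepVec 1 1 := by
  have := irrep_F (q := q) 1 0
  simpa [qInt_one hq] using this

theorem irrep_one_F_one : irrep q 1 (Uq.gen q .F) (irrepVec 1 1) = 0 := by
  rw [irrep_F, irrepVec_eq_zero (by omega), smul_zero]

theorem irrep_one_K_zero : irrep q 1 (Uq.gen q .K) (irrepVec 1 0) = (q : ℂ) • irrepVec 1 0 := by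
  simp [irrep_K]

theorem irrep_one_K_one : irrep q 1 (Uq.gen q .K) (irrepVec 1 1) = (q : ℂ)⁻¹ • irrepVec 1 1 := by
  norm_num [irrep_K]

theorem irrep_one_Kinv_zero :
    irrep q 1 (Uq.gen q .Kinv) (irrepVec 1 0) = (q : ℂ)⁻¹ • irrepVec 1 0 := by
  simp [irrep_Kinv]

theorem irrep_one_Kinv_one :
    irrep q 1 (Uq.gen q .Kinv) (irrepVec 1 1) = (q : ℂ) • irrepVec 1 1 := by
  norm_num [irrep_Kinv]

/-- It is enough to test generators on basis vectors. For `K^{±1}` the weights match; for `E` and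
`F` the comparison of coefficients is an instance of `qInt_add` with one summand equal to 1. -/
theorem isIntertwiner_cgTop (hq : (q : ℂ) - (q : ℂ)⁻¹ ≠ 0) (m : ℕ) :
    IsIntertwiner (irrep q (m + 1)) (tensorRep (irrep q m) (irrep q 1)) (cgTop q m) := by
  have hq0 : (q : ℂ) ≠ 0 := q.ne_zero
  refine .of_gen fun g => irrep_hom_ext fun j => ?_
  simp only [LinearMap.comp_apply]
  cases g
  -- Three cases, since `E` lowers the index by one and the embedding has a separate formula at
  -- index 0.
  · rcases j with _ | _ | j
    · simp only [irrep_E_zero, cgTop_zero, tensorRep_E, TensorProduct.zero_tmul, map_zero,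
        zero_add, TensorProduct.tmul_zero]
    · have h := qInt_add (q := q) m 1
      rw [qInt_one hq, zpow_one] at h
      simp only [irrep_E_zero, irrep_E_succ, cgTop_zero, cgTop_succ, tensorRep_E, irrep_K,
        irrep_one_E_one hq, map_add, map_smul, TensorProduct.zero_tmul,
        TensorProduct.tmul_zero, ← TensorProduct.smul_tmul']
      match_scalars
      push_cast
      simp only [sub_zero, mul_one, pow_one, h]
    · have h := qInt_add (q := q) (m - (j + 1)) 1
      rw [qInt_one hq, zpow_one] at h
      have h₁ : ((m + 1 : ℕ) : ℤ) - ((j + 1 : ℕ) : ℤ) = m - (j + 1) + 1 := by push_cast; ring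
      have h₂ : ((m : ℕ) : ℤ) - j = m - (j + 1) + 1 := by ring
      have h₃ : (m : ℤ) - ((j + 1 : ℕ) : ℤ) = m - (j + 1) := by push_cast; ring
      -- The weight is split so that the power `q^{m-(j+1)}` from `qInt_add` reappears; with that
      -- power and the quantum integer made opaque, only field arithmetic remains.
      have h₄ : (m : ℤ) - 2 * ((j + 1 : ℕ) : ℤ) = (m - (j + 1)) - ((j + 1 : ℕ) : ℤ) := by
        push_cast; ring
      simp only [irrep_E_zero, irrep_E_succ, cgTop_succ, tensorRep_E, irrep_K,
        irrep_one_E_one hq, map_add, map_smul, TensorProduct.tmul_zero,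
        ← TensorProduct.smul_tmul']
      rw [h₁, h₂, h₃, h₄, h, zpow_sub₀ hq0 _ ((j + 1 : ℕ) : ℤ), zpow_natCast]
      generalize qInt q (m - (j + 1)) = x
      generalize (q : ℂ) ^ ((m : ℤ) - (j + 1)) = y
      match_scalars <;> field_simp
      ring
  · rcases j with _ | j
    · simp only [irrep_F m, irrep_F (m + 1), cgTop_zero, cgTop_succ, tensorRep_F, irrep_one_F_zero hq,
        irrep_one_Kinv_zero, map_smul, ← TensorProduct.smul_tmul', TensorProduct.tmul_smul]
      simp [qInt_one hq, smul_smul]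
    · have h := qInt_add (q := q) 1 (j + 1)
      rw [qInt_one hq, zpow_one, add_comm] at h
      have h₁ : (q : ℂ) ^ ((j : ℤ) + 1) = (q : ℂ) ^ (j + 1) := by
        rw [← zpow_natCast]; push_cast; rfl
      simp only [irrep_F m, irrep_F (m + 1), cgTop_succ, tensorRep_F, irrep_one_F_zero hq,
        irrep_one_F_one, irrep_one_Kinv_zero, irrep_one_Kinv_one, map_smul, map_add,
        ← TensorProduct.smul_tmul', TensorProduct.tmul_smul, TensorProduct.tmul_zero]
      push_cast
      rw [h, h₁]
      generalize qInt q (j + 1) = x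
      match_scalars <;> field_simp
      ring
  · rcases j with _ | j
    · simp only [irrep_K m, irrep_K (m + 1), cgTop_zero, tensorRep_K, irrep_one_K_zero, map_smul,
        ← TensorProduct.smul_tmul', TensorProduct.tmul_smul, smul_smul]
      simp [zpow_add₀ hq0, mul_comm]
    · simp only [irrep_K m, irrep_K (m + 1), cgTop_succ, tensorRep_K, irrep_one_K_zero, irrep_one_K_one, map_smul,
        map_add, ← TensorProduct.smul_tmul', TensorProduct.tmul_smul]
      push_cast
      simp only [mul_add, mul_one, zpow_add₀ hq0, zpow_sub₀ hq0, zpow_ofNat]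
      match_scalars <;> field_simp
  · rcases j with _ | j
    · simp only [irrep_Kinv m, irrep_Kinv (m + 1), cgTop_zero, tensorRep_Kinv, irrep_one_Kinv_zero, map_smul,
        ← TensorProduct.smul_tmul', TensorProduct.tmul_smul, smul_smul]
      simp [zpow_add₀ hq0]
    · simp only [irrep_Kinv m, irrep_Kinv (m + 1), cgTop_succ, tensorRep_Kinv, irrep_one_Kinv_zero, irrep_one_Kinv_one,
        map_smul, map_add, ← TensorProduct.smul_tmul', TensorProduct.tmul_smul]
      push_cast
      simp only [neg_sub, mul_add, mul_one, zpow_add₀ hq0, zpow_sub₀ hq0, zpow_ofNat]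
      match_scalars <;> field_simp

theorem isIntertwiner_cgBot (hq : (q : ℂ) - (q : ℂ)⁻¹ ≠ 0) (m : ℕ) :
    IsIntertwiner (irrep q m) (tensorRep (irrep q (m + 1)) (irrep q 1)) (cgBot q m) := by
  have hq0 : (q : ℂ) ≠ 0 := q.ne_zero
  refine .of_gen fun g => irrep_hom_ext fun j => ?_
  simp only [LinearMap.comp_apply]
  cases g
  · rcases j with _ | j
    · simp only [irrep_E_zero, irrep_E_succ, cgBot_apply, tensorRep_E, irrep_K (m + 1),
        irrep_one_E_one hq, map_sub, map_smul, TensorProduct.zero_tmul,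
        TensorProduct.tmul_zero, ← TensorProduct.smul_tmul', map_zero]
      push_cast
      simp only [zero_add, qInt_one hq]
      match_scalars
      simp
      ring
    · have h := qInt_add (q := q) (m - j) 1
      rw [qInt_one hq, zpow_one] at h
      have h' := qInt_add (q := q) 1 (j + 1)
      rw [qInt_one hq, zpow_one, add_comm] at h'
      have h₁ : (m : ℤ) + 1 - (j + 1) = m - j := by ring
      have h₂ : (m : ℤ) + 1 - 2 * (j + 1) = (m - j) - (j + 1) := by ring
      have h₃ : (m : ℤ) + 1 - j = m - j + 1 := by ring
      simp only [irrep_E_succ, cgBot_apply, tensorRep_E, irrep_K (m + 1),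
        irrep_one_E_one hq, irrep_one_E_zero, map_sub, map_smul,
        TensorProduct.tmul_zero, ← TensorProduct.smul_tmul']
      push_cast
      rw [h₁, h₂, h₃, h, h', zpow_sub₀ hq0 _ ((j : ℤ) + 1), zpow_add_one₀ hq0 ((m : ℤ) - j)]
      generalize qInt q ((m : ℤ) - j) = x
      generalize (q : ℂ) ^ ((m : ℤ) - j) = z
      generalize qInt q ((j : ℤ) + 1) = y
      have hw : (q : ℂ) ^ ((j : ℤ) + 1) ≠ 0 := zpow_ne_zero _ hq0
      generalize (q : ℂ) ^ ((j : ℤ) + 1) = w at hw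
      match_scalars <;> field_simp
      ring
  · have h := qInt_add (q := q) (m - j) 1
    rw [qInt_one hq, zpow_one] at h
    have h₁ : (m : ℤ) + 1 - (j + 1) = m - j := by ring
    have h₃ : (m : ℤ) + 1 - j = m - j + 1 := by ring
    simp only [irrep_F m, irrep_F (m + 1), cgBot_apply, tensorRep_F, irrep_one_F_zero hq,
      irrep_one_F_one, irrep_one_Kinv_zero, irrep_one_Kinv_one, map_smul, map_sub,
      ← TensorProduct.smul_tmul', TensorProduct.tmul_smul, TensorProduct.tmul_zero]
    push_cast
    rw [h₁, h₃, h, zpow_add_one₀ hq0 ((m : ℤ) - j)]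
    generalize qInt q ((m : ℤ) - j) = x
    generalize (q : ℂ) ^ ((m : ℤ) - j) = z
    match_scalars <;> field_simp
    ring
  · simp only [irrep_K m, irrep_K (m + 1), cgBot_apply, tensorRep_K, irrep_one_K_zero, irrep_one_K_one, map_smul,
      map_sub, ← TensorProduct.smul_tmul', TensorProduct.tmul_smul]
    push_cast
    simp only [mul_add, mul_one, zpow_add₀ hq0, zpow_sub₀ hq0, zpow_ofNat]
    match_scalars <;> field_simp
  · simp only [irrep_Kinv m, irrep_Kinv (m + 1), cgBot_apply, tensorRep_Kinv, irrep_one_Kinv_zero, irrep_one_Kinv_one,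
      map_smul, map_sub, ← TensorProduct.smul_tmul', TensorProduct.tmul_smul]
    push_cast
    simp only [neg_sub, mul_add, mul_one, zpow_add₀ hq0, zpow_sub₀ hq0, zpow_ofNat]
    match_scalars <;> field_simp

theorem tmul_mem_of_irrepVec {m : ℕ} {R : Submodule ℂ ((Fin (m + 1) → ℂ) ⊗[ℂ] (Fin 2 → ℂ))}
    (h₀ : ∀ j, irrepVec m j ⊗ₜ irrepVec 1 0 ∈ R) (h₁ : ∀ j, irrepVec m j ⊗ₜ irrepVec 1 1 ∈ R) :
    R = ⊤ := by
  have hb := ((Pi.basisFun ℂ (Fin (m + 1))).tensorProduct (Pi.basisFun ℂ (Fin 2))).span_eq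
  rw [eq_top_iff, ← hb, Submodule.span_le]
  rintro _ ⟨⟨i, j⟩, rfl⟩
  rw [Module.Basis.tensorProduct_apply, Pi.basisFun_apply, Pi.basisFun_apply, ← irrepVec_fin,
    ← irrepVec_fin]
  fin_cases j
  · exact h₀ i
  · exact h₁ i

/-- The two vectors of a given weight in the image can be solved for `v_{j+1} ⊗ v_0`, with
determinant `[m+2]`, which is nonzero because `q` is not a root of unity. The vectors `v_j ⊗ v_1`
follow by subtraction. -/
theorem cg_surjective (hq : ∀ n : ℕ, 0 < n → q ^ n ≠ 1) (m : ℕ) :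
    Function.Surjective ((cgTop q (m + 1)).coprod (cgBot q m)) := by
  rw [← LinearMap.range_eq_top]
  set R := LinearMap.range ((cgTop q (m + 1)).coprod (cgBot q m)) with hR
  have ht : ∀ x, cgTop q (m + 1) x ∈ R := fun x => ⟨(x, 0), by simp⟩
  have hb : ∀ x, cgBot q m x ∈ R := fun x => ⟨(0, x), by simp⟩
  have h₀ : ∀ j, irrepVec (m + 1) j ⊗ₜ irrepVec 1 0 ∈ R := by
    rintro (_ | j)
    · rw [← cgTop_zero (q := q)]
      exact ht _
    -- This combination cancels the `v_j ⊗ v_1` terms and leaves the coefficient `q^{-(j+1)} [m+1-j]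
    -- + q^{m+1-j} [j+1] = [m+2]`.
    · have h := R.add_mem (R.smul_mem (qInt q (m + 1 - j)) (ht (irrepVec _ (j + 1))))
        (hb (irrepVec _ j))
      rw [cgTop_succ, cgBot_apply, smul_add, add_add_sub_cancel, smul_smul, ← add_smul] at h
      have h' := qInt_add (q := q) (m + 1 - j) (j + 1)
      have h₁ : (q : ℂ) ^ ((j : ℤ) + 1) = (q : ℂ) ^ (j + 1) := by
        rw [← zpow_natCast]; push_cast; rfl
      rw [mul_comm, ← h₁, ← h'] at h
      exact (R.smul_mem_iff (qInt_ne_zero hq (by omega))).1 h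
  refine tmul_mem_of_irrepVec h₀ fun j => ?_
  have h := ht (irrepVec _ (j + 1))
  rw [cgTop_succ] at h
  exact (R.add_mem_iff_right (R.smul_mem _ (h₀ _))).1 h

theorem cgTop_injective (hq : ∀ n : ℕ, 0 < n → q ^ n ≠ 1) (m : ℕ) :
    Function.Injective (cgTop q (m + 1)) := by
  have h : Function.Injective ((cgTop q (m + 1)).coprod (cgBot q m)) := by
    -- The dimensions agree: `(m+3) + (m+1) = 2(m+2)`.
    refine (LinearMap.injective_iff_surjective_of_finrank_eq_finrank ?_).2 (cg_surjective hq m)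
    simp
    ring
  intro x y hxy
  exact congrArg Prod.fst (@h (x, 0) (y, 0) (by simpa using hxy))

end ClebschGordan

/-! ### Linear independence of the matrix coefficients of all `V_m` -/

/-- Joint eigenvectors of commuting operators, with distinct eigenvalues, are linearly
independent. -/
theorem linearIndependent_of_joint_eigenvectors {k V ι κ : Type*} [Field k] [AddCommGroup V]
    [Module k V] {T : ι → Module.End k V} (hT : ∀ i j, Commute (T i) (T j)) {χ : κ → ι → k}
    (hχ : Function.Injective χ) {v : κ → V} (hv : ∀ x i, T i (v x) = χ x i • v x)
    (hv' : ∀ x, v x ≠ 0) : LinearIndependent k v := by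
  have h : iSupIndep fun χ : ι → k => ⨅ i, (T i).maxGenEigenspace (χ i) :=
    Module.End.independent_iInf_maxGenEigenspace_of_forall_mapsTo T
      fun i j χ => Module.End.mapsTo_maxGenEigenspace_of_comm (hT j i) χ
  have h' : iSupIndep ((fun χ : ι → k => ⨅ i, (T i).maxGenEigenspace (χ i)) ∘ χ) := h.comp hχ
  refine h'.linearIndependent _ (fun x => ?_) hv'
  refine (Submodule.mem_iInf _).2 fun i => Module.End.eigenspace_le_maxGenEigenspace ?_
  exact Module.End.mem_eigenspace_iff.2 (hv x i)

section MatrixCoefficients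

variable {q : ℂˣ}

/-- The element `(q - q⁻¹)² FE + qK + q⁻¹K⁻¹` of `U_q(𝔰𝔩₂)`, which acts on each `V_m` by a
scalar. -/
def casimir (q : ℂˣ) : Uq q :=
  ((q : ℂ) - (q : ℂ)⁻¹) ^ 2 • (Uq.gen q .F * Uq.gen q .E) + (q : ℂ) • Uq.gen q .K +
    (q : ℂ)⁻¹ • Uq.gen q .Kinv

/-- The scalar by which `casimir q` acts on `V_m`. -/
def casimirValue (q : ℂˣ) (m : ℕ) : ℂ := (q : ℂ) ^ (m + 1) + ((q : ℂ) ^ (m + 1))⁻¹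

/-- On `v_{j+1}`, expanding `(q-q⁻¹)² [m-j][j+1]` gives `q^{m+1} + q^{-(m+1)}` minus `q^{m-2j-1} +
q^{-(m-2j-1)}`, and the last two powers are exactly what `qK + q⁻¹K⁻¹` restores. -/
theorem irrep_casimir (hq : (q : ℂ) - (q : ℂ)⁻¹ ≠ 0) (m : ℕ) (v : Fin (m + 1) → ℂ) :
    irrep q m (casimir q) v = casimirValue q m • v := by
  have hq0 : (q : ℂ) ≠ 0 := q.ne_zero
  suffices h : irrep q m (casimir q) = casimirValue q m • LinearMap.id from
    LinearMap.congr_fun h v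
  refine irrep_hom_ext fun j => ?_
  simp only [casimir, map_add, map_smul, map_mul, LinearMap.add_apply, LinearMap.smul_apply,
    Module.End.mul_apply, LinearMap.id_apply, irrep_K, irrep_Kinv, casimirValue]
  rcases j with _ | j
  · rw [irrep_E_zero, map_zero, smul_zero]
    match_scalars
    simp only [mul_zero, sub_zero, zpow_neg, zpow_natCast]
    field_simp
    ring
  · rw [irrep_E_succ, map_smul, irrep_F]
    match_scalars
    have hD : ∀ n, qInt q n * ((q : ℂ) - (q : ℂ)⁻¹) = (q : ℂ) ^ n - (q : ℂ) ^ (-n) := fun n =>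
      div_mul_cancel₀ _ hq
    have h : ((q : ℂ) - (q : ℂ)⁻¹) ^ 2 * (qInt q (m - j) * qInt q (j + 1)) =
        ((q : ℂ) ^ ((m : ℤ) - j) - (q : ℂ) ^ (-((m : ℤ) - j))) *
          ((q : ℂ) ^ ((j : ℤ) + 1) - (q : ℂ) ^ (-((j : ℤ) + 1))) := by
      rw [← hD, ← hD]
      ring
    simp only [mul_one]
    rw [h]
    simp only [neg_sub, neg_add, zpow_add₀ hq0, zpow_sub₀ hq0, zpow_neg, zpow_natCast, zpow_ofNat,
      mul_comm (2 : ℤ), zpow_mul, pow_succ, pow_zero, one_mul]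
    field_simp
    ring

/-- If `x + x⁻¹ = y + y⁻¹` then `x = y` or `xy = 1`. The second is impossible for `x = q^{m+1}`, `y
= q^{n+1}`, since `q^{m+n+2} ≠ 1`. -/
theorem casimirValue_injective (hq : ∀ n : ℕ, 0 < n → q ^ n ≠ 1) :
    Function.Injective (casimirValue q) := by
  intro m n h
  have hm : (q : ℂ) ^ (m + 1) ≠ 0 := pow_ne_zero _ q.ne_zero
  have hn : (q : ℂ) ^ (n + 1) ≠ 0 := pow_ne_zero _ q.ne_zero
  have h' : ((q : ℂ) ^ (m + 1) - (q : ℂ) ^ (n + 1)) *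
      ((q : ℂ) ^ (m + 1) * (q : ℂ) ^ (n + 1) - 1) = 0 := by
    simp only [casimirValue] at h
    field_simp at h
    linear_combination h
  rcases mul_eq_zero.1 h' with h' | h'
  · have := zpow_injective (m := (m + 1 : ℕ)) (n := (n + 1 : ℕ)) hq
      (by simpa only [zpow_natCast] using sub_eq_zero.1 h')
    omega
  · rw [← pow_add] at h'
    refine absurd (sub_eq_zero.1 h') ?_
    rw [← zpow_natCast]
    exact zpow_ne_one hq (by omega)

/-- The operator `φ ↦ φ(x ·)` on the dual of `U_q(𝔰𝔩₂)`. -/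
def leftShift (x : Uq q) : Module.End ℂ (UqDual q) where
  toFun φ := WithConv.toConv (φ.ofConv ∘ₗ LinearMap.mulLeft ℂ x)
  map_add' _ _ := rfl
  map_smul' _ _ := rfl

/-- The operator `φ ↦ φ(· x)` on the dual of `U_q(𝔰𝔩₂)`. -/
def rightShift (x : Uq q) : Module.End ℂ (UqDual q) where
  toFun φ := WithConv.toConv (φ.ofConv ∘ₗ LinearMap.mulRight ℂ x)
  map_add' _ _ := rfl
  map_smul' _ _ := rfl

theorem leftShift_apply (x u : Uq q) (φ : UqDual q) : leftShift x φ u = φ (x * u) := rfl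

theorem rightShift_apply (x u : Uq q) (φ : UqDual q) : rightShift x φ u = φ (u * x) := rfl

theorem commute_leftShift_rightShift (x y : Uq q) : Commute (leftShift x) (rightShift y) := by
  ext φ u
  exact congrArg φ (mul_assoc x u y)

theorem commute_leftShift {x y : Uq q} (h : Commute x y) :
    Commute (leftShift x) (leftShift y) := by
  ext φ u
  change φ (y * (x * u)) = φ (x * (y * u))
  rw [← mul_assoc, ← mul_assoc, h.eq]

theorem commute_casimir_K (q : ℂˣ) : Commute (casimir q) (Uq.gen q .K) := by
  have hq0 : (q : ℂ) ≠ 0 := q.ne_zero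
  have h : Commute (Uq.gen q .F * Uq.gen q .E) (Uq.gen q .K) := by
    refine Commute.symm ?_
    rw [Commute, SemiconjBy, ← mul_assoc, Uq.K_F, smul_mul_assoc, mul_assoc, Uq.K_E,
      mul_smul_comm, smul_smul, inv_mul_cancel₀ (pow_ne_zero 2 hq0), one_smul, mul_assoc]
  have h' : Commute (Uq.gen q .Kinv) (Uq.gen q .K) := (Uq.Kinv_K q).trans (Uq.K_Kinv q).symm
  exact ((h.smul_left _).add_left ((Commute.refl _).smul_left _)).add_left (h'.smul_left _)

/-- The matrix coefficient `u ↦ u_{ij}` of `V_m`. -/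
def irrepCoeff (q : ℂˣ) (m : ℕ) (i j : Fin (m + 1)) : UqDual q :=
  matrixCoeff (irrep q m) (LinearMap.proj i) (irrepVec m j)

theorem irrepCoeff_apply (m : ℕ) (i j : Fin (m + 1)) (u : Uq q) :
    irrepCoeff q m i j u = irrep q m u (irrepVec m j) i := rfl

theorem irrep_K_coord (m : ℕ) (i : Fin (m + 1)) (v : Fin (m + 1) → ℂ) :
    irrep q m (Uq.gen q .K) v i = (q : ℂ) ^ ((m : ℤ) - 2 * i) * v i := by
  have h : LinearMap.proj i ∘ₗ irrep q m (Uq.gen q .K) =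
      (q : ℂ) ^ ((m : ℤ) - 2 * i) • (LinearMap.proj i : (Fin (m + 1) → ℂ) →ₗ[ℂ] ℂ) := by
    refine irrep_hom_ext fun j => ?_
    rw [LinearMap.comp_apply, irrep_K]
    by_cases hj : (i : ℕ) = j
    · simp [← hj]
    · simp [irrepVec, hj]
  exact LinearMap.congr_fun h v

theorem exists_irrep_F_pow (hq : ∀ n : ℕ, 0 < n → q ^ n ≠ 1) (m j k : ℕ) :
    ∃ r : ℂ, r ≠ 0 ∧ irrep q m (Uq.gen q .F ^ k) (irrepVec m j) = r • irrepVec m (j + k) := by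
  induction k with
  | zero => exact ⟨1, one_ne_zero, by simp⟩
  | succ k ih =>
    obtain ⟨r, hr, h⟩ := ih
    refine ⟨r * qInt q ((j + k : ℕ) + 1), mul_ne_zero hr (qInt_ne_zero hq (by omega)), ?_⟩
    rw [pow_succ', map_mul, Module.End.mul_apply, h, map_smul, irrep_F, smul_smul]
    rfl

theorem exists_irrep_E_pow (hq : ∀ n : ℕ, 0 < n → q ^ n ≠ 1) (m j k : ℕ) (h : j + k ≤ m) :
    ∃ r : ℂ, r ≠ 0 ∧ irrep q m (Uq.gen q .E ^ k) (irrepVec m (j + k)) = r • irrepVec m j := by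
  induction k with
  | zero => exact ⟨1, one_ne_zero, by simp⟩
  | succ k ih =>
    obtain ⟨r, hr, h'⟩ := ih (by omega)
    refine ⟨qInt q (m - (j + k : ℕ)) * r, mul_ne_zero (qInt_ne_zero hq (by omega)) hr, ?_⟩
    rw [pow_succ, map_mul, Module.End.mul_apply, ← add_assoc, irrep_E_succ, map_smul, h',
      smul_smul]

/-- A power of `F` (if `j ≤ i`) or of `E` (if `i ≤ j`) carries `v_j` to a nonzero multiple of `v_i`;
the multiple is a product of nonzero quantum integers. -/
theorem irrepCoeff_ne_zero (hq : ∀ n : ℕ, 0 < n → q ^ n ≠ 1) (m : ℕ) (i j : Fin (m + 1)) :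
    irrepCoeff q m i j ≠ 0 := by
  suffices h : ∃ u, ∃ r : ℂ, r ≠ 0 ∧ irrep q m u (irrepVec m j) = r • irrepVec m i by
    obtain ⟨u, r, hr, h⟩ := h
    intro h₀
    have h₁ : irrepCoeff q m i j u = 0 := by rw [h₀]; rfl
    rw [irrepCoeff_apply, h] at h₁
    exact hr (by simpa [irrepVec] using h₁)
  rcases le_total (j : ℕ) i with h | h <;> obtain ⟨k, hk⟩ := Nat.exists_eq_add_of_le h
  · rw [hk]
    exact ⟨_, exists_irrep_F_pow hq m j k⟩
  · rw [hk]
    exact ⟨_, exists_irrep_E_pow hq m i k (by omega)⟩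

theorem leftShift_casimir_irrepCoeff (hq : (q : ℂ) - (q : ℂ)⁻¹ ≠ 0) (m : ℕ)
    (i j : Fin (m + 1)) :
    leftShift (casimir q) (irrepCoeff q m i j) = casimirValue q m • irrepCoeff q m i j := by
  ext u
  rw [leftShift_apply, irrepCoeff_apply, map_mul, Module.End.mul_apply, irrep_casimir hq]
  rfl

theorem leftShift_K_irrepCoeff (m : ℕ) (i j : Fin (m + 1)) :
    leftShift (Uq.gen q .K) (irrepCoeff q m i j) =
      (q : ℂ) ^ ((m : ℤ) - 2 * i) • irrepCoeff q m i j := by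
  ext u
  rw [leftShift_apply, irrepCoeff_apply, map_mul, Module.End.mul_apply, irrep_K_coord]
  rfl

theorem rightShift_K_irrepCoeff (m : ℕ) (i j : Fin (m + 1)) :
    rightShift (Uq.gen q .K) (irrepCoeff q m i j) =
      (q : ℂ) ^ ((m : ℤ) - 2 * j) • irrepCoeff q m i j := by
  ext u
  rw [rightShift_apply, irrepCoeff_apply, map_mul, Module.End.mul_apply, irrep_K, map_smul]
  rfl

/-- Three commuting operators on the dual of `U_q(𝔰𝔩₂)` whose joint eigenvectors include the matrix
coefficients of the modules `V_m`. -/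
def cartanOp (q : ℂˣ) : Fin 3 → Module.End ℂ (UqDual q)
  | 0 => leftShift (casimir q)
  | 1 => leftShift (Uq.gen q .K)
  | 2 => rightShift (Uq.gen q .K)

theorem commute_cartanOp (q : ℂˣ) : ∀ i j, Commute (cartanOp q i) (cartanOp q j)
  | 0, 0 | 1, 1 | 2, 2 => Commute.refl _
  | 0, 1 => commute_leftShift (commute_casimir_K q)
  | 1, 0 => (commute_leftShift (commute_casimir_K q)).symm
  | 0, 2 | 1, 2 => commute_leftShift_rightShift _ _
  | 2, 0 | 2, 1 => (commute_leftShift_rightShift _ _).symm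

/-- The joint eigenvalues of the operators `cartanOp` on the matrix coefficients. -/
def cartanValue (q : ℂˣ) (x : Σ m : ℕ, Fin (m + 1) × Fin (m + 1)) : Fin 3 → ℂ
  | 0 => casimirValue q x.1
  | 1 => (q : ℂ) ^ ((x.1 : ℤ) - 2 * x.2.1)
  | 2 => (q : ℂ) ^ ((x.1 : ℤ) - 2 * x.2.2)

/-- The Casimir eigenvalue determines `m`; left and right translation by `K` then determine the row
and the column. -/
theorem cartanValue_injective (hq : ∀ n : ℕ, 0 < n → q ^ n ≠ 1) :
    Function.Injective (cartanValue q) := by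
  rintro ⟨m, i, j⟩ ⟨m', i', j'⟩ h
  obtain rfl : m = m' := casimirValue_injective hq (congrFun h 0)
  have hi : (m : ℤ) - 2 * i = m - 2 * i' := zpow_injective hq (congrFun h 1)
  have hj : (m : ℤ) - 2 * j = m - 2 * j' := zpow_injective hq (congrFun h 2)
  obtain rfl : i = i' := Fin.ext (by omega)
  obtain rfl : j = j' := Fin.ext (by omega)
  rfl

theorem cartanOp_irrepCoeff (hq : (q : ℂ) - (q : ℂ)⁻¹ ≠ 0)
    (x : Σ m : ℕ, Fin (m + 1) × Fin (m + 1)) : ∀ l, cartanOp q l (irrepCoeff q x.1 x.2.1 x.2.2) =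
      cartanValue q x l • irrepCoeff q x.1 x.2.1 x.2.2
  | 0 => leftShift_casimir_irrepCoeff hq _ _ _
  | 1 => leftShift_K_irrepCoeff _ _ _
  | 2 => rightShift_K_irrepCoeff _ _ _

/-- The independence half of the Peter–Weyl theorem, and the source of the lower bound on the
dimension of `gr`. -/
theorem linearIndependent_irrepCoeff (hq : ∀ n : ℕ, 0 < n → q ^ n ≠ 1) :
    LinearIndependent ℂ
      fun x : Σ m : ℕ, Fin (m + 1) × Fin (m + 1) => irrepCoeff q x.1 x.2.1 x.2.2 := by
  exact linearIndependent_of_joint_eigenvectors (commute_cartanOp q) (cartanValue_injective hq)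
    (cartanOp_irrepCoeff (sub_inv_ne_zero hq)) fun x => irrepCoeff_ne_zero hq _ _ _

theorem coeffSpace_irrep (q : ℂˣ) (m : ℕ) : coeffSpace (irrep q m) =
    Submodule.span ℂ (Set.range fun x : Fin (m + 1) × Fin (m + 1) => irrepCoeff q m x.1 x.2) := by
  refine le_antisymm (Submodule.span_le.2 ?_) (Submodule.span_le.2 ?_)
  · rintro _ ⟨f, v, rfl⟩
    have hv : v = ∑ j : Fin (m + 1), v j • irrepVec m j := by
      simp only [irrepVec_fin]
      exact pi_eq_sum_univ' v
    have hf : f = ∑ i : Fin (m + 1), f (irrepVec m i) • (LinearMap.proj i : (Fin (m + 1) → ℂ) →ₗ[ℂ] ℂ) := by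
      refine irrep_hom_ext fun j => ?_
      rcases Nat.lt_or_ge m j with h | h
      · rw [irrepVec_eq_zero h, map_zero, map_zero]
      · obtain ⟨j, rfl⟩ : ∃ i : Fin (m + 1), (i : ℕ) = j := ⟨⟨j, by omega⟩, rfl⟩
        simp [irrepVec, Fin.val_inj]
    have h : matrixCoeff (irrep q m) f v =
        ∑ i : Fin (m + 1), ∑ j : Fin (m + 1), (f (irrepVec m i) * v j) • irrepCoeff q m i j := by
      ext u
      have hsum : (∑ i : Fin (m + 1), ∑ j : Fin (m + 1),
          (f (irrepVec m i) * v j) • irrepCoeff q m i j).ofConv u =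
            ∑ i : Fin (m + 1), ∑ j : Fin (m + 1),
              (f (irrepVec m i) * v j) • (irrep q m u (irrepVec m j) i) := by
        simp only [WithConv.ofConv_sum, WithConv.ofConv_smul, LinearMap.sum_apply,
          LinearMap.smul_apply]
        rfl
      refine Eq.trans ?_ hsum.symm
      change f (irrep q m u v) = _
      conv_lhs => rw [hv, hf]
      simp only [map_sum, map_smul, LinearMap.sum_apply, LinearMap.smul_apply,
        LinearMap.proj_apply, smul_eq_mul, Finset.mul_sum]
      rw [Finset.sum_comm]
      refine Finset.sum_congr rfl fun i _ => Finset.sum_congr rfl fun j _ => ?_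
      ring
    rw [h]
    exact Submodule.sum_mem _ fun i _ => Submodule.sum_mem _ fun j _ =>
      Submodule.smul_mem _ _ (Submodule.subset_span ⟨(i, j), rfl⟩)
  · rintro _ ⟨x, rfl⟩
    exact matrixCoeff_mem _ _ _

end MatrixCoefficients

/-! ### From the fusion rule to powers of one generating subspace -/

section FusionRule

variable {k A : Type*} [CommRing k] [Ring A] [Algebra k A] {C D : ℕ → Submodule k A}

/-- `hC` puts `C m` inside `C 1 ^ m`, and `1 ≤ C 1 ^ 2` allows the exponent to be raised by any even
number. -/
theorem le_pow_of_fusion (h₀ : C 0 = 1) (hC : ∀ m, C (m + 1) ≤ C m * C 1) (h₁ : 1 ≤ C 1 ^ 2)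
    (m r : ℕ) : C m ≤ C 1 ^ (m + 2 * r) := by
  have h : C m ≤ C 1 ^ m := by
    induction m with
    | zero => rw [h₀, pow_zero]
    | succ m ih => exact (hC m).trans (by rw [pow_succ]; gcongr)
  rw [pow_add, pow_mul]
  calc C m ≤ C 1 ^ m * 1 := by rwa [mul_one]
    _ ≤ _ := by
      gcongr
      exact one_le_pow_of_one_le' h₁ r

/-- `hD` and `hD'` together say that `D n` is the join of the `C m` with `n - m` even and
nonnegative. Its containment in the power is `le_pow_of_fusion`; the converse is an induction in
which `hC'` gives `D n * C 1 ≤ D (n + 1)`. -/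
theorem eq_pow_of_fusion (h₀ : C 0 = 1) (hC : ∀ m, C (m + 1) ≤ C m * C 1) (h₁ : 1 ≤ C 1 ^ 2)
    (hC' : ∀ m, C (m + 1) * C 1 ≤ C (m + 2) ⊔ C m) (hD : ∀ m r, C m ≤ D (m + 2 * r))
    (hD' : ∀ n B, (∀ m r, n = m + 2 * r → C m ≤ B) → D n ≤ B) (n : ℕ) : D n = C 1 ^ n := by
  refine le_antisymm (hD' n _ fun m r h => h ▸ le_pow_of_fusion h₀ hC h₁ m r) ?_
  induction n with
  | zero =>
    rw [pow_zero, ← h₀]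
    exact hD 0 0
  | succ n ih =>
    rw [pow_succ]
    refine (mul_le_mul_left ih _).trans (Submodule.mul_le.2 fun x hx y hy => ?_)
    have h : D n ≤ (D (n + 1)).comap (LinearMap.mulRight k y) := by
      refine hD' n _ ?_
      rintro m r rfl z hz
      -- `hC'` says nothing about `C 0 * C 1`, but `C 0 = 1`, so that product is `C 1`.
      rcases m with _ | m
      · rw [h₀] at hz
        have h := Submodule.mul_mem_mul hz hy
        rw [one_mul] at h
        have h' := hD 1 r h
        rwa [show 1 + 2 * r = 0 + 2 * r + 1 by ring] at h'
      · have h₂ := hD (m + 2) r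
        have h₃ := hD m (r + 1)
        rw [show m + 2 + 2 * r = m + 1 + 2 * r + 1 by ring] at h₂
        rw [show m + 2 * (r + 1) = m + 1 + 2 * r + 1 by ring] at h₃
        exact sup_le h₂ h₃ (hC' m (Submodule.mul_mem_mul hz hy))
    exact h hx

theorem mul_le_of_fusion (hD : ∀ n, D n = C 1 ^ n) (m n : ℕ) : D m * D n ≤ D (m + n) := by
  rw [hD, hD, hD, pow_add]

theorem one_mem_of_fusion (hD : ∀ n, D n = C 1 ^ n) : (1 : A) ∈ D 0 := by
  rw [hD, pow_zero]
  exact Submodule.one_le.1 le_rfl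

end FusionRule

/-! ### The Peter–Weyl filtration and a lower bound for its graded pieces -/

section PeterWeylFiltration

variable {q : ℂˣ}

theorem coeffSpace_irrep_zero (q : ℂˣ) : coeffSpace (irrep q 0) = 1 := by
  have h : ∀ f v, matrixCoeff (irrep q 0) f v = algebraMap ℂ (UqDual q) (f v) := by
    intro f v
    ext u
    change f (irrep q 0 u v) = f v * Uq.counit q u
    rw [irrep_zero_apply, map_smul, smul_eq_mul, mul_comm]
  refine le_antisymm (Submodule.span_le.2 ?_) ?_
  · rintro _ ⟨f, v, rfl⟩
    rw [h]
    exact Submodule.algebraMap_mem _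
  · rw [Submodule.one_le, ← map_one (algebraMap ℂ (UqDual q))]
    have := matrixCoeff_mem (irrep q 0) (LinearMap.proj 0) (irrepVec 0 0)
    rw [h] at this
    simpa [irrepVec] using this

theorem coeffSpace_mul_le (hq : ∀ n : ℕ, 0 < n → q ^ n ≠ 1) (m : ℕ) :
    coeffSpace (irrep q (m + 1)) * coeffSpace (irrep q 1) ≤
      coeffSpace (irrep q (m + 2)) ⊔ coeffSpace (irrep q m) := by
  rw [coeffSpace_mul]
  exact (isIntertwiner_cgTop (sub_inv_ne_zero hq) (m + 1)).coeffSpace_le_sup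
    (isIntertwiner_cgBot (sub_inv_ne_zero hq) m) (cg_surjective hq m)

theorem coeffSpace_le_mul (hq : ∀ n : ℕ, 0 < n → q ^ n ≠ 1) (m : ℕ) :
    coeffSpace (irrep q (m + 1)) ≤ coeffSpace (irrep q m) * coeffSpace (irrep q 1) := by
  rcases m with _ | m
  · rw [coeffSpace_irrep_zero, Submodule.one_mul]
  · rw [coeffSpace_mul]
    exact (isIntertwiner_cgTop (sub_inv_ne_zero hq) (m + 1)).coeffSpace_le (cgTop_injective hq m)

theorem genCoeff_mem (g : MatGen) : genCoeff q g ∈ coeffSpace (irrep q 1) := by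
  cases g <;> exact matrixCoeff_mem _ _ _

theorem span_genCoeff (q : ℂˣ) :
    Submodule.span ℂ (Set.range (genCoeff q)) = coeffSpace (irrep q 1) := by
  refine le_antisymm (Submodule.span_le.2 ?_) ?_
  · rintro _ ⟨g, rfl⟩
    exact genCoeff_mem g
  · rw [coeffSpace_irrep]
    refine Submodule.span_mono ?_
    rintro _ ⟨⟨i, j⟩, rfl⟩
    have h : irrepCoeff q 1 i j = stdCoeff q i j := by rw [irrepCoeff, irrepVec_fin]; rfl
    simp only [h]
    fin_cases i <;> fin_cases j
    exacts [⟨.a, rfl⟩, ⟨.b, rfl⟩, ⟨.c, rfl⟩, ⟨.d, rfl⟩]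

/-- The relation `ad - q bc = 1` exhibits the unit as a quadratic expression in the coefficients of
`V_1`. -/
theorem one_le_coeffSpace_sq (q : ℂˣ) : 1 ≤ coeffSpace (irrep q 1) ^ 2 := by
  obtain ⟨-, -, -, -, -, -, h⟩ := genCoeff_rel q
  rw [Submodule.one_le, ← h, pow_two]
  exact sub_mem (Submodule.mul_mem_mul (genCoeff_mem _) (genCoeff_mem _))
    (Submodule.smul_mem _ _ (Submodule.mul_mem_mul (genCoeff_mem _) (genCoeff_mem _)))

theorem Weight.natCast_injective : Function.Injective (Nat.cast : ℕ → Weight) :=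
  fun _ _ h => Int.ofNat_inj.1 h

theorem Weight.natCast_le_iff {m : ℕ} {n : Weight} :
    (m : Weight) ≤ n ↔ ∃ r : ℕ, n = (m + 2 * r : ℕ) := by
  simp only [Nat.cast_add, Nat.cast_mul, Nat.cast_ofNat]
  rfl

theorem coeffSpace_le_coeffSpan {m : ℕ} {n : Weight} (h : (m : Weight) ≤ n) :
    coeffSpace (irrep q m) ≤ coeffSpan q n := by
  refine Submodule.span_mono ?_
  rintro _ ⟨f, v, rfl⟩
  exact ⟨m, h, f, v, rfl⟩

theorem coeffSpan_le {n : Weight} {B : Submodule ℂ (UqDual q)}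
    (h : ∀ m : ℕ, (m : Weight) ≤ n → coeffSpace (irrep q m) ≤ B) : coeffSpan q n ≤ B := by
  refine Submodule.span_le.2 ?_
  rintro _ ⟨m, hm, f, v, rfl⟩
  exact h m hm (matrixCoeff_mem _ _ _)

theorem coeffSpan_mono : Monotone (coeffSpan q) := fun _ _ h =>
  coeffSpan_le fun _ hm => coeffSpace_le_coeffSpan (hm.trans h)

/-- Up to the identification with matrix coefficients, the filtration is by degree in `a, b, c, d`:
this gives its multiplicativity and supplies polynomial representatives for the elements of each
step. -/
theorem coeffSpan_natCast (hq : ∀ n : ℕ, 0 < n → q ^ n ≠ 1) (n : ℕ) :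
    coeffSpan q n = coeffSpace (irrep q 1) ^ n :=
  eq_pow_of_fusion (C := fun m => coeffSpace (irrep q m)) (D := fun n => coeffSpan q (n : ℕ))
    (coeffSpace_irrep_zero q) (coeffSpace_le_mul hq) (one_le_coeffSpace_sq q)
    (coeffSpace_mul_le hq) (fun m r => coeffSpace_le_coeffSpan (Weight.natCast_le_iff.2 ⟨r, rfl⟩))
    (fun n B h => coeffSpan_le fun m hm => by
      obtain ⟨r, hr⟩ := Weight.natCast_le_iff.1 hm
      exact h m r (Weight.natCast_injective hr)) n

/-- In the dominance order a weight above a natural number is itself a natural number, so negative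
weights dominate no `V_m`. -/
theorem coeffSpan_eq_bot {n : Weight} (h : n ∉ Set.range (Nat.cast : ℕ → Weight)) :
    coeffSpan q n = ⊥ := by
  refine le_bot_iff.1 (coeffSpan_le fun m hm => ?_)
  obtain ⟨r, hr⟩ := Weight.natCast_le_iff.1 hm
  exact absurd ⟨_, hr.symm⟩ h

theorem coeffSpan_mul_le (hq : ∀ n : ℕ, 0 < n → q ^ n ≠ 1) (i j : Weight) :
    coeffSpan q i * coeffSpan q j ≤ coeffSpan q (i + j) := by
  by_cases hi : i ∈ Set.range (Nat.cast : ℕ → Weight)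
  · by_cases hj : j ∈ Set.range (Nat.cast : ℕ → Weight)
    · obtain ⟨i, rfl⟩ := hi
      obtain ⟨j, rfl⟩ := hj
      rw [← Nat.cast_add]
      exact mul_le_of_fusion (C := fun m => coeffSpace (irrep q m))
        (D := fun n => coeffSpan q (n : ℕ)) (coeffSpan_natCast hq) i j
    · rw [coeffSpan_eq_bot hj, Submodule.mul_bot]
      exact bot_le
  · rw [coeffSpan_eq_bot hi, Submodule.bot_mul]
    exact bot_le

theorem isRingFiltration_peterWeyl (hq : ∀ n : ℕ, 0 < n → q ^ n ≠ 1) :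
    IsRingFiltration (peterWeyl q) (filtrationLT (peterWeyl q)) where
  mono _ _ h := Submodule.comap_mono (coeffSpan_mono h)
  is_le h := le_iSup₂_of_le _ h le_rfl
  is_sup _ _ h := iSup₂_le h
  one_mem := by
    change toUqDual q 1 ∈ coeffSpan q 0
    have h := one_mem_of_fusion (C := fun m => coeffSpace (irrep q m))
      (D := fun n => coeffSpan q (n : ℕ)) (coeffSpan_natCast hq)
    rw [map_one]
    simpa only [Nat.cast_zero] using h
  mul_mem i j x y hx hy := by
    change toUqDual q (x * y) ∈ coeffSpan q (i + j)
    rw [map_mul]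
    exact coeffSpan_mul_le hq i j (Submodule.mul_mem_mul hx hy)

/-- Every element of `F_n` therefore agrees, modulo the kernel of `toUqDual`, with a combination of
words of length `n` in the generators. -/
theorem map_span_gen_pow (hq : ∀ n : ℕ, 0 < n → q ^ n ≠ 1) (n : ℕ) :
    (Submodule.span ℂ (Set.range (OqFibre.gen q 1)) ^ n).map (toUqDual q).toLinearMap =
      coeffSpan q n := by
  rw [coeffSpan_natCast hq, ← span_genCoeff, Submodule.map_pow, Submodule.map_span,
    ← Set.range_comp]
  congr 3
  exact funext fun g => toUqDual_gen q g

/-- The span of the matrix coefficients of the modules `V_m` with `m ≠ n`. -/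
def coeffSpanNe (q : ℂˣ) (n : ℕ) : Submodule ℂ (UqDual q) :=
  Submodule.span ℂ
    ((fun x : Σ m : ℕ, Fin (m + 1) × Fin (m + 1) => irrepCoeff q x.1 x.2.1 x.2.2) ''
      {x | x.1 ≠ n})

theorem filtrationLT_peterWeyl_le (n : ℕ) : filtrationLT (peterWeyl q) (n : Weight) ≤
    (coeffSpanNe q n).comap (toUqDual q).toLinearMap := by
  refine iSup₂_le fun j hj => Submodule.comap_mono (coeffSpan_le fun m hm => ?_)
  rw [coeffSpace_irrep]
  refine Submodule.span_mono ?_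
  rintro _ ⟨x, rfl⟩
  refine ⟨⟨m, x⟩, ?_, rfl⟩
  rintro rfl
  exact absurd hm hj.not_ge

/-- Disjoint subfamilies of an independent family span disjoint subspaces, so killing the
coefficients of the other modules leaves those of `V_n` independent. -/
theorem linearIndependent_mkQ_irrepCoeff (hq : ∀ n : ℕ, 0 < n → q ^ n ≠ 1) (n : ℕ) :
    LinearIndependent ℂ fun x : Fin (n + 1) × Fin (n + 1) =>
      (coeffSpanNe q n).mkQ (irrepCoeff q n x.1 x.2) := by
  have h := linearIndependent_irrepCoeff hq
  refine (h.comp (fun x : Fin (n + 1) × Fin (n + 1) => (⟨n, x⟩ : Σ m : ℕ, Fin (m + 1) × Fin (m + 1)))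
    fun x y h => by simpa using h).map ?_
  rw [Submodule.ker_mkQ, Set.range_comp]
  refine h.disjoint_span_image (Set.disjoint_left.2 ?_)
  rintro _ ⟨x, rfl⟩ hx
  exact hx rfl

/-- Since `F_{<n}` maps into the span of the coefficients of the `V_m` with `m ≠ n`, the piece `F_n
/ F_{<n}` maps to the quotient of the dual by that span, where the `(n+1)²` coefficients of `V_n`
stay independent. The bound uses `Module.rank` because finite dimension of the piece is not yet
known. -/
theorem le_rank_grPiece (hq : ∀ n : ℕ, 0 < n → q ^ n ≠ 1) (n : ℕ) :
    (((n + 1) * (n + 1) : ℕ) : Cardinal) ≤ Module.rank ℂ (GrPiece (peterWeyl q) (n : Weight)) := by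
  have hx : ∀ x : Fin (n + 1) × Fin (n + 1), ∃ y : peterWeyl q (n : Weight),
      toUqDual q y = irrepCoeff q n x.1 x.2 := by
    intro x
    have h : irrepCoeff q n x.1 x.2 ∈ coeffSpan q n :=
      coeffSpace_le_coeffSpan le_rfl (matrixCoeff_mem _ _ _)
    obtain ⟨y, -, hy⟩ := (map_span_gen_pow hq n).ge h
    have hy' : toUqDual q y = irrepCoeff q n x.1 x.2 := hy
    refine ⟨⟨y, ?_⟩, hy⟩
    change toUqDual q y ∈ coeffSpan q n
    rwa [hy']
  choose y hy using hx
  let f : GrPiece (peterWeyl q) (n : Weight) →ₗ[ℂ] UqDual q ⧸ coeffSpanNe q n :=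
    Submodule.liftQ _ ((coeffSpanNe q n).mkQ ∘ₗ (toUqDual q).toLinearMap ∘ₗ
      (peterWeyl q (n : Weight)).subtype) fun z hz => by
        refine (Submodule.Quotient.mk_eq_zero _).2 ?_
        exact filtrationLT_peterWeyl_le n hz
  have h : LinearIndependent ℂ fun x => grMk (peterWeyl q) (n : Weight) (y x) := by
    refine LinearIndependent.of_comp f ?_
    convert linearIndependent_mkQ_irrepCoeff hq n using 2 with x
    rw [← hy x]
    rfl
  simpa using h.cardinal_le_rank

/-- The kernel of `toUqDual` lies in every step of the filtration, in particular in that of weight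
`n - 2`, which is strictly below `n`. Hence `gr` does not see the kernel. -/
theorem mem_filtrationLT_of_toUqDual_eq_zero {x : OqSL2 q} (hx : toUqDual q x = 0)
    (n : Weight) : x ∈ filtrationLT (peterWeyl q) n := by
  have h : n - 2 < n := by
    refine lt_of_le_of_ne ⟨1, by simp⟩ fun h => ?_
    exact Weight.natCast_injective.ne two_ne_zero (by simpa using h)
  have hx' : x ∈ peterWeyl q (n - 2) := by
    change toUqDual q x ∈ coeffSpan q (n - 2)
    rw [hx]
    exact zero_mem _
  exact Submodule.mem_iSup_of_mem _ (Submodule.mem_iSup_of_mem h hx')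

theorem grPiece_subsingleton {n : Weight} (h : n ∉ Set.range (Nat.cast : ℕ → Weight)) :
    Subsingleton (GrPiece (peterWeyl q) n) := by
  refine Submodule.Quotient.subsingleton_iff.2 (eq_top_iff.2 ?_)
  rintro ⟨x, hx⟩ -
  have hx' : toUqDual q x ∈ coeffSpan q n := hx
  rw [coeffSpan_eq_bot h] at hx'
  exact mem_filtrationLT_of_toUqDual_eq_zero hx' n

end PeterWeylFiltration

/-! ### Bijectivity of graded maps by dimension count -/

section GradedMaps

variable {k A : Type*} [Field k] [AddCommGroup A] [Module k A] {ι : Type*} [DecidableEq ι]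
  {G : ι → Type*} [∀ i, AddCommGroup (G i)] [∀ i, Module k (G i)]

/-- A linear map to a graded space that maps each `W n` onto a homogeneous component of dimension
at least that of `W n` is bijective. -/
theorem bijective_of_graded {W : ℕ → Submodule k A} (hW : ⨆ n, W n = ⊤)
    [∀ n, Module.Finite k (W n)] {ν : ℕ → ι} (hν : Function.Injective ν)
    (hG : ∀ i, i ∉ Set.range ν → Subsingleton (G i)) (f : A →ₗ[k] ⨁ i, G i)
    (hf : ∀ n, (W n).map f = LinearMap.range (DirectSum.lof k ι G (ν n)))
    (hrank : ∀ n, (Module.finrank k (W n) : Cardinal) ≤ Module.rank k (G (ν n))) :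
    Function.Bijective f := by
  have hlof : ∀ i, Function.Injective (DirectSum.lof k ι G i) := fun i =>
    DFinsupp.single_injective
  -- Surjectivity makes the target component finite-dimensional, so the rank bound becomes equality
  -- of dimensions and the surjection onto the component is injective.
  have hinj : ∀ n, ∀ x ∈ W n, f x = 0 → x = 0 := by
    intro n
    have hmem : ∀ x : W n, f x ∈ LinearMap.range (DirectSum.lof k ι G (ν n)) := fun x => by
      rw [← hf]
      exact Submodule.mem_map_of_mem x.2
    let g : W n →ₗ[k] LinearMap.range (DirectSum.lof k ι G (ν n)) :=
      (f ∘ₗ (W n).subtype).codRestrict _ hmem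
    have hg : Function.Surjective g := by
      rintro ⟨y, hy⟩
      rw [← hf] at hy
      obtain ⟨x, hx, rfl⟩ := hy
      exact ⟨⟨x, hx⟩, rfl⟩
    have : Module.Finite k (LinearMap.range (DirectSum.lof k ι G (ν n))) :=
      Module.Finite.of_surjective g hg
    have e := LinearEquiv.ofInjective _ (hlof (ν n))
    have : Module.Finite k (G (ν n)) := Module.Finite.equiv e.symm
    have hle : Module.finrank k (W n) ≤
        Module.finrank k (LinearMap.range (DirectSum.lof k ι G (ν n))) := by
      rw [← e.finrank_eq]
      have := hrank n
      rwa [← Module.finrank_eq_rank, Nat.cast_le] at this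
    have heq := le_antisymm hle (LinearMap.finrank_le_finrank_of_surjective hg)
    have hg' := (LinearMap.injective_iff_surjective_of_finrank_eq_finrank heq).2 hg
    intro x hx hfx
    have h0 : g ⟨x, hx⟩ = 0 := Subtype.ext hfx
    exact congrArg Subtype.val (hg' (h0.trans (map_zero g).symm))
  constructor
  · refine (injective_iff_map_eq_zero f).2 fun x hx => ?_
    have hx' : x ∈ ⨆ n, W n := hW ▸ Submodule.mem_top
    classical
    -- The `W n` are not assumed independent. Their images lie in different summands of the target,
    -- as `ν` is injective, so projecting to one summand isolates each `f (y n)`.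
    obtain ⟨y, hyx⟩ := (Submodule.mem_iSup_iff_exists_dfinsupp' _ _).1 hx'
    rw [← hyx] at hx ⊢
    have hy : ∀ n, ∃ z, DirectSum.lof k ι G (ν n) z = f (y n) := fun n => by
      have h := Submodule.mem_map_of_mem (f := f) (y n).2
      rwa [hf] at h
    choose z hz using hy
    rw [DFinsupp.sum, map_sum] at hx
    refine Finset.sum_eq_zero fun n hn => hinj n _ (y n).2 ?_
    have h := congrArg (DirectSum.component k ι G (ν n)) hx
    rw [map_sum, Finset.sum_eq_single n] at h
    · rw [← hz, DirectSum.component.lof_self, map_zero] at h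
      rw [← hz, h, map_zero]
    · intro m _ hm
      rw [← hz, DirectSum.component.of, dif_neg (hν.ne hm)]
    · exact fun h => absurd hn h
  · rw [← LinearMap.range_eq_top, eq_top_iff]
    rintro x -
    induction x using DirectSum.induction_on with
    | zero => exact zero_mem _
    | add x y hx hy => exact add_mem hx hy
    | of i x =>
      by_cases hi : i ∈ Set.range ν
      · obtain ⟨n, rfl⟩ := hi
        have h : DirectSum.lof k ι G (ν n) x ∈ (W n).map f := (hf n).ge ⟨x, rfl⟩
        obtain ⟨y, -, hy⟩ := h
        exact ⟨y, hy⟩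
      · have := hG i hi
        rw [Subsingleton.elim x 0, map_zero]
        exact zero_mem _

/-- The sum of the powers contains the scalars and the generators and is closed under products,
because exponents add. -/
theorem iSup_span_pow {A : Type*} [Ring A] [Algebra k A] {s : Set A}
    (hs : Algebra.adjoin k s = ⊤) : ⨆ n : ℕ, Submodule.span k s ^ n = ⊤ := by
  rw [eq_top_iff]
  rintro x -
  have hx : x ∈ Algebra.adjoin k s := hs ▸ Algebra.mem_top
  have hle : ∀ n : ℕ, Submodule.span k s ^ n ≤ ⨆ n : ℕ, Submodule.span k s ^ n :=
    le_iSup fun n : ℕ => Submodule.span k s ^ n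
  induction hx using Algebra.adjoin_induction with
  | mem x hx => exact hle 1 (by rw [pow_one]; exact Submodule.subset_span hx)
  | algebraMap r => exact hle 0 (by rw [pow_zero]; exact Submodule.algebraMap_mem r)
  | add x y _ _ hx hy => exact add_mem hx hy
  | mul x y _ _ hx hy =>
    have h := Submodule.mul_mem_mul hx hy
    rw [Submodule.iSup_mul] at h
    refine (iSup_le fun m => ?_ : _ ≤ ⨆ n : ℕ, Submodule.span k s ^ n) h
    rw [Submodule.mul_iSup]
    exact iSup_le fun n => by rw [← pow_add]; exact hle _

end GradedMaps

/-! ### The algebra `O_q(Mat₂) / ⟨ad - qbc⟩`: normal monomials and an upper bound on dimensions -/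

section QuantumMatrices

variable {q : ℂˣ} {t : ℂ}

theorem OqFibre.gen_rel (q : ℂˣ) (t : ℂ) {x y : FreeAlgebra ℂ MatGen} (h : MatRel q x y) :
    FreeAlgebra.lift ℂ (OqFibre.gen q t) x = FreeAlgebra.lift ℂ (OqFibre.gen q t) y := by
  have h' : FreeAlgebra.lift ℂ (OqFibre.gen q t) =
      (Presented.mk (FibreRel q t)).comp (Presented.mk (MatRel q)) :=
    FreeAlgebra.hom_ext (funext fun g => by simp [OqFibre.gen, OqMat.gen])
  rw [h', AlgHom.comp_apply, AlgHom.comp_apply, Presented.mk_rel h]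

theorem OqFibre.a_b (q : ℂˣ) (t : ℂ) : OqFibre.gen q t .a * OqFibre.gen q t .b =
    (q : ℂ) • (OqFibre.gen q t .b * OqFibre.gen q t .a) := by
  simpa using OqFibre.gen_rel q t .a_b

theorem OqFibre.a_c (q : ℂˣ) (t : ℂ) : OqFibre.gen q t .a * OqFibre.gen q t .c =
    (q : ℂ) • (OqFibre.gen q t .c * OqFibre.gen q t .a) := by
  simpa using OqFibre.gen_rel q t .a_c

theorem OqFibre.b_c (q : ℂˣ) (t : ℂ) : OqFibre.gen q t .b * OqFibre.gen q t .c =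
    OqFibre.gen q t .c * OqFibre.gen q t .b := by
  simpa using OqFibre.gen_rel q t .b_c

theorem OqFibre.b_d (q : ℂˣ) (t : ℂ) : OqFibre.gen q t .b * OqFibre.gen q t .d =
    (q : ℂ) • (OqFibre.gen q t .d * OqFibre.gen q t .b) := by
  simpa using OqFibre.gen_rel q t .b_d

theorem OqFibre.c_d (q : ℂˣ) (t : ℂ) : OqFibre.gen q t .c * OqFibre.gen q t .d =
    (q : ℂ) • (OqFibre.gen q t .d * OqFibre.gen q t .c) := by
  simpa using OqFibre.gen_rel q t .c_d

theorem OqFibre.a_d_sub (q : ℂˣ) (t : ℂ) : OqFibre.gen q t .a * OqFibre.gen q t .d -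
    OqFibre.gen q t .d * OqFibre.gen q t .a =
      ((q : ℂ) - (q : ℂ)⁻¹) • (OqFibre.gen q t .b * OqFibre.gen q t .c) := by
  simpa using OqFibre.gen_rel q t .a_d

theorem OqFibre.det (q : ℂˣ) (t : ℂ) : OqFibre.gen q t .a * OqFibre.gen q t .d -
    (q : ℂ) • (OqFibre.gen q t .b * OqFibre.gen q t .c) = algebraMap ℂ _ t := by
  simpa [qDet, OqFibre.gen] using Presented.mk_rel (FibreRel.det (q := q) (t := t))

theorem OqFibre.adjoin_range_gen (q : ℂˣ) (t : ℂ) :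
    Algebra.adjoin ℂ (Set.range (OqFibre.gen q t)) = ⊤ := by
  let f : FreeAlgebra ℂ MatGen →ₐ[ℂ] OqFibre q t :=
    (Presented.mk (FibreRel q t)).comp (Presented.mk (MatRel q))
  have hf : Function.Surjective f := Presented.mk_surjective.comp Presented.mk_surjective
  have h := congrArg (Subalgebra.map f) (FreeAlgebra.adjoin_range_ι ℂ MatGen)
  rw [AlgHom.map_adjoin, ← Set.range_comp, Algebra.map_top, (AlgHom.range_eq_top f).2 hf] at h
  exact h

/-- The universal property of `O_q(Mat₂) / ⟨D_q - t⟩`. -/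
def OqFibre.lift {B : Type*} [Ring B] [Algebra ℂ B] (f : MatGen → B)
    (h₁ : f .a * f .b = (q : ℂ) • (f .b * f .a)) (h₂ : f .a * f .c = (q : ℂ) • (f .c * f .a))
    (h₃ : f .b * f .c = f .c * f .b) (h₄ : f .b * f .d = (q : ℂ) • (f .d * f .b))
    (h₅ : f .c * f .d = (q : ℂ) • (f .d * f .c))
    (h₆ : f .a * f .d - f .d * f .a = ((q : ℂ) - (q : ℂ)⁻¹) • (f .b * f .c))
    (h₇ : f .a * f .d - (q : ℂ) • (f .b * f .c) = algebraMap ℂ B t) : OqFibre q t →ₐ[ℂ] B :=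
  Presented.lift
    (Presented.lift (FreeAlgebra.lift ℂ f) (by
      rintro _ _ (_ | _ | _ | _ | _ | _) <;> simpa))
    (by
      rintro _ _ ⟨⟩
      simpa [qDet, OqMat.gen] using h₇)

theorem OqFibre.lift_gen {B : Type*} [Ring B] [Algebra ℂ B] (f : MatGen → B)
    (h₁ h₂ h₃ h₄ h₅ h₆ h₇) (g : MatGen) :
    OqFibre.lift (q := q) (t := t) f h₁ h₂ h₃ h₄ h₅ h₆ h₇ (OqFibre.gen q t g) = f g := by
  simp [OqFibre.lift, OqFibre.gen, OqMat.gen]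

theorem mul_pow_of_qcommute {A : Type*} [Ring A] [Algebra ℂ A] {x y : A} {r : ℂ}
    (h : x * y = r • (y * x)) (n : ℕ) : x * y ^ n = r ^ n • (y ^ n * x) := by
  induction n with
  | zero => simp
  | succ n ih =>
    rw [pow_succ, ← mul_assoc, ih, smul_mul_assoc, mul_assoc, h, mul_smul_comm, smul_smul,
      mul_assoc, pow_succ]

theorem OqSing.a_d (q : ℂˣ) : OqFibre.gen q 0 .a * OqFibre.gen q 0 .d =
    (q : ℂ) • (OqFibre.gen q 0 .b * OqFibre.gen q 0 .c) := by
  simpa [sub_eq_zero] using OqFibre.det q 0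

theorem OqSing.d_a (q : ℂˣ) : OqFibre.gen q 0 .d * OqFibre.gen q 0 .a =
    (q : ℂ)⁻¹ • (OqFibre.gen q 0 .b * OqFibre.gen q 0 .c) := by
  have h := OqFibre.a_d_sub q 0
  rw [OqSing.a_d, sub_smul, sub_right_inj] at h
  exact h

theorem OqSing.d_b (q : ℂˣ) : OqFibre.gen q 0 .d * OqFibre.gen q 0 .b =
    (q : ℂ)⁻¹ • (OqFibre.gen q 0 .b * OqFibre.gen q 0 .d) := by
  rw [OqFibre.b_d, smul_smul, inv_mul_cancel₀ q.ne_zero, one_smul]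

theorem OqSing.d_c (q : ℂˣ) : OqFibre.gen q 0 .d * OqFibre.gen q 0 .c =
    (q : ℂ)⁻¹ • (OqFibre.gen q 0 .c * OqFibre.gen q 0 .d) := by
  rw [OqFibre.c_d, smul_smul, inv_mul_cancel₀ q.ne_zero, one_smul]

/-- The ordered monomial `b^j c^k a^i d^l`. -/
def OqSing.monomial (q : ℂˣ) (j k i l : ℕ) : OqSing q :=
  OqFibre.gen q 0 .b ^ j * OqFibre.gen q 0 .c ^ k *
    (OqFibre.gen q 0 .a ^ i * OqFibre.gen q 0 .d ^ l)

/-- The span of the ordered monomials of degree `n` that do not contain both `a` and `d`. -/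
def OqSing.normalSpan (q : ℂˣ) (n : ℕ) : Submodule ℂ (OqSing q) :=
  Submodule.span ℂ
    {x | ∃ j k i l, j + k + i + l = n ∧ (i = 0 ∨ l = 0) ∧ x = OqSing.monomial q j k i l}

theorem OqSing.monomial_mem {n j k i l : ℕ} (h : j + k + i + l = n) (h' : i = 0 ∨ l = 0) :
    OqSing.monomial q j k i l ∈ OqSing.normalSpan q n :=
  Submodule.subset_span ⟨j, k, i, l, h, h', rfl⟩

theorem OqSing.b_mul_monomial (q : ℂˣ) (j k i l : ℕ) :
    OqFibre.gen q 0 .b * OqSing.monomial q j k i l = OqSing.monomial q (j + 1) k i l := by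
  simp only [OqSing.monomial, pow_succ', mul_assoc]

theorem OqSing.c_mul_monomial (q : ℂˣ) (j k i l : ℕ) :
    OqFibre.gen q 0 .c * OqSing.monomial q j k i l = OqSing.monomial q j (k + 1) i l := by
  have h : Commute (OqFibre.gen q 0 .c) (OqFibre.gen q 0 .b) := (OqFibre.b_c q 0).symm
  simp only [OqSing.monomial, pow_succ', ← mul_assoc, (h.pow_right j).eq]

/-- Applied to `x = a` with `r = q` and to `x = d` with `r = q⁻¹`: either generator moves past the
`b, c` part of a monomial at the cost of a scalar. -/
theorem OqSing.mul_bc {x : OqSing q} {r : ℂ}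
    (hb : x * OqFibre.gen q 0 .b = r • (OqFibre.gen q 0 .b * x))
    (hc : x * OqFibre.gen q 0 .c = r • (OqFibre.gen q 0 .c * x)) (j k : ℕ) (y : OqSing q) :
    x * (OqFibre.gen q 0 .b ^ j * OqFibre.gen q 0 .c ^ k * y) =
      (r ^ j * r ^ k) • (OqFibre.gen q 0 .b ^ j * OqFibre.gen q 0 .c ^ k * (x * y)) := by
  rw [← mul_assoc, ← mul_assoc, mul_pow_of_qcommute hb, smul_mul_assoc, mul_assoc (_ ^ j),
    mul_pow_of_qcommute hc, mul_smul_comm, smul_smul, smul_mul_assoc]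
  simp only [mul_assoc]

theorem OqSing.bc_mul (q : ℂˣ) (j k : ℕ) (y : OqSing q) :
    OqFibre.gen q 0 .b ^ j * OqFibre.gen q 0 .c ^ k *
      (OqFibre.gen q 0 .b * OqFibre.gen q 0 .c * y) =
      OqFibre.gen q 0 .b ^ (j + 1) * OqFibre.gen q 0 .c ^ (k + 1) * y := by
  have h : Commute (OqFibre.gen q 0 .c) (OqFibre.gen q 0 .b) := (OqFibre.b_c q 0).symm
  simp only [pow_succ, mul_assoc]
  rw [← mul_assoc (_ ^ k) (OqFibre.gen q 0 .b), (h.pow_left k).eq]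
  simp only [mul_assoc]

/-- After `a` has passed `b` and `c`, it either joins the power of `a` or meets a `d`, and then `ad
= q bc` turns the pair into one more `b` and one more `c`. The degree rises by exactly one in both
cases. -/
theorem OqSing.a_mul_monomial_mem {n j k i l : ℕ} (h : j + k + i + l = n) (h' : i = 0 ∨ l = 0) :
    OqFibre.gen q 0 .a * OqSing.monomial q j k i l ∈ OqSing.normalSpan q (n + 1) := by
  rw [OqSing.monomial, OqSing.mul_bc (OqFibre.a_b q 0) (OqFibre.a_c q 0)]
  refine Submodule.smul_mem _ _ ?_
  by_cases hl : l = 0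
  · subst hl
    rw [← mul_assoc (OqFibre.gen q 0 .a), ← pow_succ']
    exact OqSing.monomial_mem (by omega) (.inr rfl)
  · obtain rfl : i = 0 := h'.resolve_right hl
    obtain ⟨l, rfl⟩ := Nat.exists_eq_succ_of_ne_zero hl
    rw [pow_zero, one_mul, pow_succ', ← mul_assoc (OqFibre.gen q 0 .a), OqSing.a_d, smul_mul_assoc, mul_smul_comm,
      OqSing.bc_mul]
    refine Submodule.smul_mem _ _ ?_
    have := OqSing.monomial_mem (q := q) (n := n + 1) (j := j + 1) (k := k + 1) (i := 0) (l := l)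
      (by omega) (.inl rfl)
    rwa [OqSing.monomial, pow_zero, one_mul] at this

theorem OqSing.d_mul_monomial_mem {n j k i l : ℕ} (h : j + k + i + l = n) (h' : i = 0 ∨ l = 0) :
    OqFibre.gen q 0 .d * OqSing.monomial q j k i l ∈ OqSing.normalSpan q (n + 1) := by
  rw [OqSing.monomial, OqSing.mul_bc (OqSing.d_b q) (OqSing.d_c q)]
  refine Submodule.smul_mem _ _ ?_
  by_cases hi : i = 0
  · subst hi
    rw [pow_zero, one_mul, ← pow_succ']
    have := OqSing.monomial_mem (q := q) (n := n + 1) (j := j) (k := k) (i := 0) (l := l + 1)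
      (by omega) (.inl rfl)
    rwa [OqSing.monomial, pow_zero, one_mul] at this
  · obtain rfl : l = 0 := h'.resolve_left hi
    obtain ⟨i, rfl⟩ := Nat.exists_eq_succ_of_ne_zero hi
    rw [pow_succ', ← mul_assoc (OqFibre.gen q 0 .d), ← mul_assoc (OqFibre.gen q 0 .d), OqSing.d_a, smul_mul_assoc, smul_mul_assoc,
      mul_smul_comm, mul_assoc (OqFibre.gen q 0 .b * _), OqSing.bc_mul]
    refine Submodule.smul_mem _ _ ?_
    exact OqSing.monomial_mem (by omega) (.inr rfl)

theorem OqSing.gen_mul_monomial_mem (g : MatGen) {n j k i l : ℕ} (h : j + k + i + l = n)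
    (h' : i = 0 ∨ l = 0) :
    OqFibre.gen q 0 g * OqSing.monomial q j k i l ∈ OqSing.normalSpan q (n + 1) := by
  cases g
  · exact OqSing.a_mul_monomial_mem h h'
  · rw [OqSing.b_mul_monomial]
    exact OqSing.monomial_mem (by omega) h'
  · rw [OqSing.c_mul_monomial]
    exact OqSing.monomial_mem (by omega) h'
  · exact OqSing.d_mul_monomial_mem h h'

/-- The normal monomials include 1, and left multiplication by a generator keeps their span while
raising the degree, so induction on word length applies. -/
theorem OqSing.component_le (q : ℂˣ) (n : ℕ) :
    OqSing.component q n ≤ OqSing.normalSpan q n := by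
  induction n with
  | zero =>
    rw [OqSing.component, pow_zero, Submodule.one_le]
    have := OqSing.monomial_mem (q := q) (n := 0) (j := 0) (k := 0) (i := 0) (l := 0) rfl (.inl rfl)
    simpa [OqSing.monomial] using this
  | succ n ih =>
    rw [OqSing.component, pow_succ']
    refine (mul_le_mul_right ih _).trans ?_
    rw [OqSing.normalSpan, Submodule.span_mul_span, Submodule.span_le]
    rintro _ ⟨_, ⟨g, rfl⟩, _, ⟨j, k, i, l, h, h', rfl⟩, rfl⟩
    exact OqSing.gen_mul_monomial_mem g h h'

theorem OqSing.component_le_span_range (q : ℂˣ) (n : ℕ) : OqSing.component q n ≤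
    Submodule.span ℂ (Set.range fun x : Fin (n + 1) × Fin (n + 1) =>
      OqSing.monomial q (min x.1 (n - x.2)) (min x.2 (n - x.1)) (x.1 + x.2 - n)
        (n - x.1 - x.2)) := by
  refine (OqSing.component_le q n).trans (Submodule.span_mono ?_)
  rintro _ ⟨j, k, i, l, h, h', rfl⟩
  -- The pair `(j+i, k+i)` counts the letters from the first row and from the first column. As `i =
  -- 0` or `l = 0`, the truncated differences recover the exponents: `j + k + 2i - n` gives `i`, `n
  -- - (j+i) - (k+i)` gives `l`, and `min (j+i) (j+l) = j`.
  refine ⟨(⟨j + i, by omega⟩, ⟨k + i, by omega⟩), ?_⟩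
  simp only
  congr 1 <;> omega

instance (n : ℕ) : Module.Finite ℂ (OqSing.component q n) :=
  have := Module.Finite.span_of_finite ℂ (Set.finite_range
    fun x : Fin (n + 1) × Fin (n + 1) =>
      OqSing.monomial q (min x.1 (n - x.2)) (min x.2 (n - x.1)) (x.1 + x.2 - n) (n - x.1 - x.2))
  Submodule.finiteDimensional_of_le (OqSing.component_le_span_range q n)

theorem OqSing.finrank_component_le (q : ℂˣ) (n : ℕ) :
    Module.finrank ℂ (OqSing.component q n) ≤ (n + 1) * (n + 1) := by
  have := Module.Finite.span_of_finite ℂ (Set.finite_range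
    fun x : Fin (n + 1) × Fin (n + 1) =>
      OqSing.monomial q (min x.1 (n - x.2)) (min x.2 (n - x.1)) (x.1 + x.2 - n) (n - x.1 - x.2))
  refine (Submodule.finrank_mono (OqSing.component_le_span_range q n)).trans ?_
  refine (finrank_range_le_card _).trans ?_
  simp

theorem OqSing.iSup_component (q : ℂˣ) : ⨆ n, OqSing.component q n = ⊤ :=
  iSup_span_pow (OqFibre.adjoin_range_gen q 0)

end QuantumMatrices

/-! ### Calculus of symbols in an associated graded algebra -/

section Symbols

variable {ι k A : Type*} [PartialOrder ι] [CommRing k] [Ring A] [Algebra k A]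
  {F : ι → Submodule k A} [DecidableEq ι]

theorem grOf_sub {i : ι} (x y : F i) : grOf F i (x - y) = grOf F i x - grOf F i y := by
  rw [grOf, map_sub, map_sub]
  rfl

theorem grOf_smul {i : ι} (r : k) (x : F i) : grOf F i (r • x) = r • grOf F i x := by
  rw [grOf, map_smul]
  exact map_smul (DirectSum.lof k ι (GrPiece F) i) r _

/-- Allows the degree to change along a propositional equality, such as that between the cast of `n
+ 1` and a sum of weights. -/
theorem grOf_congr {i j : ι} (h : i = j) {x : F i} {y : F j} (hxy : (x : A) = y) :
    grOf F i x = grOf F j y :=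
  DirectSum.of_eq_of_gradedMonoid_eq (grMk_congr F h x y hxy)

theorem grOf_eq_zero {i : ι} {x : F i} (h : (x : A) ∈ filtrationLT F i) : grOf F i x = 0 := by
  have h' : grMk F i x = 0 := (Submodule.Quotient.mk_eq_zero _).2 h
  rw [grOf, h', map_zero]

theorem grOf_mem (i : ι) (x : F i) : grOf F i x ∈ grComponent F i := ⟨grMk F i x, rfl⟩

theorem exists_grOf_of_mem {i : ι} {y : AssocGraded F} (hy : y ∈ grComponent F i) :
    ∃ x, grOf F i x = y := by
  obtain ⟨z, rfl⟩ := hy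
  obtain ⟨x, rfl⟩ := grMk_surjective F i z
  exact ⟨x, rfl⟩

variable [AddCommMonoid ι] [IsRingFiltration F (filtrationLT F)]

theorem one_mem_grComponent : (1 : AssocGraded F) ∈ grComponent F 0 := grOf_mem 0 _

variable [IsOrderedCancelAddMonoid ι]

theorem grOf_mul {i j : ι} (x : F i) (y : F j) :
    grOf F i x * grOf F j y = grOf F (i + j) ⟨x * y, SetLike.mul_mem_graded x.2 y.2⟩ := by
  rw [grOf, grOf, DirectSum.of_mul_of]
  rfl

theorem mul_mem_grComponent {i j : ι} {x y : AssocGraded F} (hx : x ∈ grComponent F i)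
    (hy : y ∈ grComponent F j) : x * y ∈ grComponent F (i + j) := by
  obtain ⟨x, rfl⟩ := exists_grOf_of_mem hx
  obtain ⟨y, rfl⟩ := exists_grOf_of_mem hy
  rw [grOf_mul]
  exact grOf_mem _ _

end Symbols

/-! ### The isomorphism between `O_q(Mat₂) / ⟨ad - qbc⟩` and `gr(O_q(SL₂))` -/

section GradedIso

variable (q : ℂˣ) [IsRingFiltration (peterWeyl q) (filtrationLT (peterWeyl q))]

/-- The symbol of a generator. -/
def symbolGen (g : MatGen) : AssocGraded (peterWeyl q) :=
  grOf (peterWeyl q) 1 ⟨OqFibre.gen q 1 g, gen_mem_peterWeyl q g⟩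

variable {q} in
theorem symbolGen_mul (g h : MatGen) : symbolGen q g * symbolGen q h =
    grOf (peterWeyl q) (1 + 1) ⟨OqFibre.gen q 1 g * OqFibre.gen q 1 h,
      SetLike.mul_mem_graded (gen_mem_peterWeyl q g) (gen_mem_peterWeyl q h)⟩ :=
  grOf_mul _ _

/-- The morphism from `O_q(Mat₂) / ⟨ad - qbc⟩` to the associated graded algebra of the Peter–Weyl
filtration. -/
def toGr : OqSing q →ₐ[ℂ] AssocGraded (peterWeyl q) :=
  OqFibre.lift (symbolGen q)
    (by
      rw [symbolGen_mul, symbolGen_mul, ← grOf_smul]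
      exact grOf_congr rfl (OqFibre.a_b q 1))
    (by
      rw [symbolGen_mul, symbolGen_mul, ← grOf_smul]
      exact grOf_congr rfl (OqFibre.a_c q 1))
    (by
      rw [symbolGen_mul, symbolGen_mul]
      exact grOf_congr rfl (OqFibre.b_c q 1))
    (by
      rw [symbolGen_mul, symbolGen_mul, ← grOf_smul]
      exact grOf_congr rfl (OqFibre.b_d q 1))
    (by
      rw [symbolGen_mul, symbolGen_mul, ← grOf_smul]
      exact grOf_congr rfl (OqFibre.c_d q 1))
    (by
      rw [symbolGen_mul, symbolGen_mul, symbolGen_mul, ← grOf_smul, ← grOf_sub]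
      exact grOf_congr rfl (OqFibre.a_d_sub q 1))
    (by
      rw [symbolGen_mul, symbolGen_mul, ← grOf_smul, ← grOf_sub, map_zero]
      -- In `O_q(SL₂)` this element is 1, of weight 0, and `0 < 2` in the dominance order, so its
      -- symbol in degree 2 is zero.
      refine grOf_eq_zero ?_
      change OqFibre.gen q 1 .a * OqFibre.gen q 1 .d -
        (q : ℂ) • (OqFibre.gen q 1 .b * OqFibre.gen q 1 .c) ∈ _
      rw [OqFibre.det, map_one]
      have h : (0 : Weight) < 1 + 1 := by
        refine lt_of_le_of_ne ⟨1, by norm_num⟩ fun h => ?_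
        exact Weight.natCast_injective.ne two_ne_zero.symm (by simpa [one_add_one_eq_two] using h)
      exact Submodule.mem_iSup_of_mem 0 (Submodule.mem_iSup_of_mem h (SetLike.one_mem_graded _)))

theorem toGr_gen (g : MatGen) : toGr q (OqFibre.gen q 0 g) = symbolGen q g :=
  OqFibre.lift_gen _ _ _ _ _ _ _ _ g

theorem map_component_le (n : ℕ) : (OqSing.component q n).map (toGr q).toLinearMap ≤
    grComponent (peterWeyl q) (n : Weight) := by
  rw [Submodule.map_le_iff_le_comap]
  induction n with
  | zero =>
    rw [OqSing.component, pow_zero, Submodule.one_le]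
    change toGr q 1 ∈ grComponent (peterWeyl q) (0 : ℕ)
    rw [map_one, Nat.cast_zero]
    exact one_mem_grComponent
  | succ n ih =>
    rw [OqSing.component, pow_succ]
    refine Submodule.mul_le.2 fun x hx y hy => ?_
    change toGr q (x * y) ∈ grComponent (peterWeyl q) (n + 1 : ℕ)
    rw [map_mul, Nat.cast_succ]
    refine mul_mem_grComponent (ih hx) ?_
    have h : Submodule.span ℂ (Set.range (OqFibre.gen q 0)) ≤
        (grComponent (peterWeyl q) 1).comap (toGr q).toLinearMap := by
      refine Submodule.span_le.2 ?_
      rintro _ ⟨g, rfl⟩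
      change toGr q _ ∈ grComponent (peterWeyl q) 1
      rw [toGr_gen]
      exact grOf_mem _ _
    exact h hy

/-- The elements of `O_q(SL₂)_{≤ n}` whose symbol is in the image of degree `n`. -/
def symbolRange (n : ℕ) : Submodule ℂ (OqSL2 q) :=
  (((OqSing.component q n).map (toGr q).toLinearMap).comap
    (DirectSum.lof ℂ Weight (GrPiece (peterWeyl q)) n ∘ₗ grMk (peterWeyl q) n)).map
      (peterWeyl q n).subtype

variable {q}

theorem mem_symbolRange {n : ℕ} {x : OqSL2 q} : x ∈ symbolRange q n ↔
    ∃ (hx : x ∈ peterWeyl q n) (y : _) (_ : y ∈ OqSing.component q n),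
      toGr q y = grOf (peterWeyl q) n ⟨x, hx⟩ := by
  constructor
  · rintro ⟨x, ⟨y, hy, hxy⟩, rfl⟩
    exact ⟨x.2, y, hy, hxy⟩
  · rintro ⟨hx, y, hy, hxy⟩
    exact ⟨⟨x, hx⟩, ⟨y, hy, hxy⟩, rfl⟩

/-- A word of length `n` in `O_q(SL₂)` has as its symbol in degree `n` the image of the same word in
the singular algebra, by multiplicativity of symbols. -/
theorem span_gen_pow_le (n : ℕ) :
    Submodule.span ℂ (Set.range (OqFibre.gen q 1)) ^ n ≤ symbolRange q n := by
  induction n with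
  | zero =>
    rw [pow_zero, Submodule.one_le, mem_symbolRange]
    have h : (1 : OqSL2 q) ∈ peterWeyl q (0 : ℕ) := by
      rw [Nat.cast_zero]
      exact SetLike.one_mem_graded _
    refine ⟨h, 1, by rw [OqSing.component, pow_zero]; exact Submodule.one_le.1 le_rfl, ?_⟩
    rw [map_one]
    exact grOf_congr (i := 0) (x := ⟨1, SetLike.one_mem_graded _⟩) Nat.cast_zero.symm rfl
  | succ n ih =>
    rw [pow_succ, Submodule.mul_le]
    intro x hx y hy
    have hy' : y ∈ symbolRange q 1 := by
      refine (Submodule.span_le.2 ?_ : _ ≤ symbolRange q 1) hy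
      rintro _ ⟨g, rfl⟩
      refine mem_symbolRange.2 ⟨by rw [Nat.cast_one]; exact gen_mem_peterWeyl q g,
        OqFibre.gen q 0 g, ?_, ?_⟩
      · rw [OqSing.component, pow_one]
        exact Submodule.subset_span ⟨g, rfl⟩
      · rw [toGr_gen]
        exact grOf_congr Nat.cast_one.symm rfl
    obtain ⟨hx, x', hx', h₁⟩ := mem_symbolRange.1 (ih hx)
    obtain ⟨hy, y', hy', h₂⟩ := mem_symbolRange.1 hy'
    have h : ((n + 1 : ℕ) : Weight) = (n : Weight) + (1 : ℕ) := Nat.cast_add n 1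
    refine mem_symbolRange.2 ⟨by rw [h]; exact SetLike.mul_mem_graded hx hy, x' * y', ?_, ?_⟩
    · rw [OqSing.component, pow_add]
      exact Submodule.mul_mem_mul hx' hy'
    · rw [map_mul, h₁, h₂, grOf_mul]
      exact grOf_congr h.symm rfl

theorem map_toGr_component (hq : ∀ n : ℕ, 0 < n → q ^ n ≠ 1) (n : ℕ) :
    (OqSing.component q n).map (toGr q).toLinearMap =
      grComponent (peterWeyl q) (n : Weight) := by
  refine le_antisymm (map_component_le q n) fun z hz => ?_
  obtain ⟨x, rfl⟩ := exists_grOf_of_mem hz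
  -- `y` is a combination of words of length `n` with the same image as `x` in the dual; `x - y` is
  -- in the kernel of `toUqDual`, so `x` and `y` have equal symbols.
  obtain ⟨y, hy, hxy⟩ := (map_span_gen_pow hq n).ge x.2
  obtain ⟨hy', w, hw, hwy⟩ := mem_symbolRange.1 (span_gen_pow_le n hy)
  refine ⟨w, hw, ?_⟩
  refine hwy.trans (sub_eq_zero.1 ?_).symm
  rw [← grOf_sub]
  refine grOf_eq_zero (mem_filtrationLT_of_toUqDual_eq_zero ?_ _)
  have hxy' : toUqDual q y = toUqDual q x := hxy
  change toUqDual q (x - y) = 0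
  rw [map_sub, hxy', sub_self]

theorem toGr_bijective (hq : ∀ n : ℕ, 0 < n → q ^ n ≠ 1) : Function.Bijective (toGr q) :=
  bijective_of_graded (OqSing.iSup_component q) Weight.natCast_injective
    (fun _ => grPiece_subsingleton) (toGr q).toLinearMap (map_toGr_component hq)
    fun n => (Nat.cast_le.2 (OqSing.finrank_component_le q n)).trans (le_rank_grPiece hq n)

end GradedIso

/-! ### Monomials of the quantum plane and a lower bound for `Sym_q^n ⊗ Sym_q^n` -/

section QuantumPlaneBasis

variable (q : ℂˣ)

theorem Plane.gen_mul_gen : Plane.gen q 0 * Plane.gen q 1 =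
    (q : ℂ) • (Plane.gen q 1 * Plane.gen q 0) := by
  simpa [Plane.gen] using Presented.mk_rel (PlaneRel.x_y (q := q))

/-- The operators by which `x` and `y` act on the space with basis `y^j x^i`. -/
def planeOp : Fin 2 → Module.End ℂ (ℕ × ℕ →₀ ℂ)
  | 0 => Finsupp.linearCombination ℂ fun p => Finsupp.single (p.1 + 1, p.2) ((q : ℂ) ^ p.2)
  | 1 => Finsupp.linearCombination ℂ fun p => Finsupp.single (p.1, p.2 + 1) 1

theorem planeOp_zero_single (i j : ℕ) : planeOp q 0 (Finsupp.single (i, j) 1) =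
    (q : ℂ) ^ j • Finsupp.single (i + 1, j) 1 := by
  simp [planeOp]

theorem planeOp_one_single (i j : ℕ) : planeOp q 1 (Finsupp.single (i, j) 1) =
    Finsupp.single (i, j + 1) 1 := by
  simp [planeOp]

/-- The regular representation of the quantum plane, in the basis `y^j x^i`. -/
def planeRep : Plane q →ₐ[ℂ] Module.End ℂ (ℕ × ℕ →₀ ℂ) :=
  Presented.lift (FreeAlgebra.lift ℂ (planeOp q)) (by
    rintro _ _ ⟨⟩
    simp only [map_mul, map_smul, FreeAlgebra.lift_ι_apply]
    refine Finsupp.lhom_ext' fun ⟨i, j⟩ => LinearMap.ext_ring ?_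
    simp only [LinearMap.comp_apply, Finsupp.lsingle_apply, Module.End.mul_apply,
      LinearMap.smul_apply, planeOp_zero_single, planeOp_one_single, map_smul, smul_smul,
      pow_succ'])

theorem planeRep_gen (i : Fin 2) : planeRep q (Plane.gen q i) = planeOp q i := by
  simp [planeRep, Plane.gen]

theorem planeRep_monomial (i j : ℕ) :
    planeRep q (Plane.gen q 1 ^ j * Plane.gen q 0 ^ i) (Finsupp.single (0, 0) 1) =
      Finsupp.single (i, j) 1 := by
  have h₀ : (planeOp q 0 ^ i) (Finsupp.single (0, 0) 1) = Finsupp.single (i, 0) 1 := by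
    induction i with
    | zero => rfl
    | succ i ih => rw [pow_succ', Module.End.mul_apply, ih, planeOp_zero_single, pow_zero, one_smul]
  have h₁ : (planeOp q 1 ^ j) (Finsupp.single (i, 0) 1) = Finsupp.single (i, j) 1 := by
    induction j with
    | zero => rfl
    | succ j ih => rw [pow_succ', Module.End.mul_apply, ih, planeOp_one_single]
  rw [map_mul, map_pow, map_pow, planeRep_gen, planeRep_gen, Module.End.mul_apply, h₀, h₁]

/-- Acting on the basis vector of index `(0, 0)` sends the monomials to distinct basis vectors, so
no relation between them is possible. -/
theorem linearIndependent_plane_monomial : LinearIndependent ℂ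
    fun p : ℕ × ℕ => Plane.gen q 1 ^ p.2 * Plane.gen q 0 ^ p.1 := by
  refine LinearIndependent.of_comp
    (LinearMap.applyₗ (Finsupp.single (0, 0) 1) ∘ₗ (planeRep q).toLinearMap) ?_
  convert Finsupp.linearIndependent_single_one ℂ (ℕ × ℕ) using 2 with p
  exact planeRep_monomial q p.1 p.2

theorem Plane.monomial_mem (n : ℕ) (i : Fin (n + 1)) :
    Plane.gen q 1 ^ (n - i : ℕ) * Plane.gen q 0 ^ (i : ℕ) ∈ symq q n := by
  have h : ∀ l, Plane.gen q l ∈ Submodule.span ℂ (Set.range (Plane.gen q)) := fun l =>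
    Submodule.subset_span ⟨l, rfl⟩
  have h' := Submodule.mul_mem_mul (Submodule.pow_mem_pow _ (h 1) (n - i))
    (Submodule.pow_mem_pow _ (h 0) i)
  rwa [← pow_add, Nat.sub_add_cancel (by omega)] at h'

theorem linearIndependent_symq (n : ℕ) : LinearIndependent ℂ fun i : Fin (n + 1) =>
    (⟨_, Plane.monomial_mem q n i⟩ : symq q n) := by
  have h := (linearIndependent_plane_monomial q).comp
    (fun i : Fin (n + 1) => ((i : ℕ), (n - i : ℕ))) fun i j h => Fin.ext (congrArg Prod.fst h)
  exact LinearIndependent.of_comp (symq q n).subtype h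

theorem map_symq_injective (n : ℕ) : Function.Injective
    (TensorProduct.map (symq q n).subtype (symq q n).subtype) :=
  TensorProduct.map_injective_of_flat_flat _ _ (Submodule.subtype_injective _)
    (Submodule.subtype_injective _)

/-- Over a field the tensor product of the two inclusions is injective, so the piece has the rank of
the abstract tensor product, which is at least `(n+1)²`. -/
theorem le_rank_segrePiece (n : ℕ) :
    (((n + 1) * (n + 1) : ℕ) : Cardinal) ≤ Module.rank ℂ (segrePiece q n) := by
  have h := (linearIndependent_symq q n).cardinal_le_rank
  rw [Cardinal.mk_fin] at h
  rw [segrePiece, rank_range_of_injective _ (map_symq_injective q n), rank_tensorProduct',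
    Nat.cast_mul]
  gcongr

end QuantumPlaneBasis

/-! ### The isomorphism between `O_q(Mat₂) / ⟨ad - qbc⟩` and the Segre algebra -/

section Segre

variable (q : ℂˣ)

/-- The element of degree `n` of the Segre algebra given by an element of
`Sym_q^n(ℂ²) ⊗ Sym_q^n(ℂ²)`. -/
def segreOf (n : ℕ) : segrePiece q n →ₗ[ℂ] SegreAlg q :=
  DirectSum.lof ℂ ℕ (fun k => segrePiece q k) n

variable {q}

theorem segreOf_mul {m n : ℕ} (x : segrePiece q m) (y : segrePiece q n) :
    segreOf q m x * segreOf q n y = segreOf q (m + n) ⟨x * y, SetLike.mul_mem_graded x.2 y.2⟩ :=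
  DirectSum.of_mul_of _ _

theorem segreOf_mem (n : ℕ) (x : segrePiece q n) : segreOf q n x ∈ SegreAlg.component q n :=
  ⟨x, rfl⟩

theorem segreGen_mul (i j k l : Fin 2) : SegreAlg.gen q i j * SegreAlg.gen q k l =
    segreOf q (1 + 1) ⟨(Plane.gen q i * Plane.gen q k) ⊗ₜ (Plane.gen q j * Plane.gen q l),
      by
        rw [← Algebra.TensorProduct.tmul_mul_tmul]
        exact SetLike.mul_mem_graded (gen_tmul_gen_mem q i j) (gen_tmul_gen_mem q k l)⟩ := by
  refine (segreOf_mul ⟨_, gen_tmul_gen_mem q i j⟩ ⟨_, gen_tmul_gen_mem q k l⟩).trans ?_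
  congr 1
  exact Subtype.ext (Algebra.TensorProduct.tmul_mul_tmul _ _ _ _)

variable (q)

/-- The images of the generators in the Segre algebra. -/
def segreGen : MatGen → SegreAlg q
  | .a => SegreAlg.gen q 0 0
  | .b => SegreAlg.gen q 0 1
  | .c => SegreAlg.gen q 1 0
  | .d => SegreAlg.gen q 1 1

/-- The morphism from `O_q(Mat₂) / ⟨ad - qbc⟩` to the Segre algebra. -/
def toSegre : OqSing q →ₐ[ℂ] SegreAlg q :=
  OqFibre.lift (segreGen q)
    (by
      simp only [segreGen, segreGen_mul, ← map_smul]
      congr 1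
      refine Subtype.ext ?_
      simp [Plane.gen_mul_gen])
    (by
      simp only [segreGen, segreGen_mul, ← map_smul]
      congr 1
      refine Subtype.ext ?_
      simp [Plane.gen_mul_gen, TensorProduct.smul_tmul'])
    (by
      simp only [segreGen, segreGen_mul]
      congr 1
      refine Subtype.ext ?_
      simp [Plane.gen_mul_gen, TensorProduct.smul_tmul])
    (by
      simp only [segreGen, segreGen_mul, ← map_smul]
      congr 1
      refine Subtype.ext ?_
      simp [Plane.gen_mul_gen, TensorProduct.smul_tmul'])
    (by
      simp only [segreGen, segreGen_mul, ← map_smul]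
      congr 1
      refine Subtype.ext ?_
      simp [Plane.gen_mul_gen])
    (by
      simp only [segreGen, segreGen_mul, ← map_smul]
      refine (map_sub (segreOf q (1 + 1)) _ _).symm.trans ?_
      congr 1
      refine Subtype.ext ?_
      simp [Plane.gen_mul_gen, ← TensorProduct.smul_tmul', smul_smul, sub_mul, sub_smul])
    (by
      simp only [segreGen, segreGen_mul, ← map_smul]
      refine (map_sub (segreOf q (1 + 1)) _ _).symm.trans ?_
      rw [map_zero, ← map_zero (segreOf q (1 + 1))]
      congr 1
      refine Subtype.ext ?_
      simp [Plane.gen_mul_gen])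

theorem toSegre_gen (g : MatGen) : toSegre q (OqFibre.gen q 0 g) = segreGen q g :=
  OqFibre.lift_gen _ _ _ _ _ _ _ _ g

theorem segreGen_mem (g : MatGen) : segreGen q g ∈ SegreAlg.component q 1 := by
  cases g <;> exact segreOf_mem 1 _

variable {q} in
theorem SegreAlg.mul_mem_component {m n : ℕ} {x y : SegreAlg q}
    (hx : x ∈ SegreAlg.component q m) (hy : y ∈ SegreAlg.component q n) :
    x * y ∈ SegreAlg.component q (m + n) := by
  obtain ⟨x, rfl⟩ := hx
  obtain ⟨y, rfl⟩ := hy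
  exact (segreOf_mul x y).symm ▸ segreOf_mem _ _

theorem map_toSegre_component_le (n : ℕ) : (OqSing.component q n).map (toSegre q).toLinearMap ≤
    SegreAlg.component q n := by
  rw [Submodule.map_le_iff_le_comap]
  induction n with
  | zero =>
    rw [OqSing.component, pow_zero, Submodule.one_le]
    change toSegre q 1 ∈ SegreAlg.component q 0
    rw [map_one]
    exact segreOf_mem 0 _
  | succ n ih =>
    rw [OqSing.component, pow_succ]
    refine Submodule.mul_le.2 fun x hx y hy => ?_
    change toSegre q (x * y) ∈ SegreAlg.component q (n + 1)
    rw [map_mul]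
    refine SegreAlg.mul_mem_component (ih hx) ?_
    have h : Submodule.span ℂ (Set.range (OqFibre.gen q 0)) ≤
        (SegreAlg.component q 1).comap (toSegre q).toLinearMap := by
      refine Submodule.span_le.2 ?_
      rintro _ ⟨g, rfl⟩
      change toSegre q _ ∈ SegreAlg.component q 1
      rw [toSegre_gen]
      exact segreGen_mem q g
    exact h hy

/-- The elements of `Sym_q^n(ℂ²) ⊗ Sym_q^n(ℂ²)` that are in the image of degree `n`. -/
def segreRange (n : ℕ) : Submodule ℂ (Plane q ⊗[ℂ] Plane q) :=
  (((OqSing.component q n).map (toSegre q).toLinearMap).comap (segreOf q n)).map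
    (segrePiece q n).subtype

variable {q}

theorem mem_segreRange {n : ℕ} {x : Plane q ⊗[ℂ] Plane q} : x ∈ segreRange q n ↔
    ∃ (hx : x ∈ segrePiece q n) (y : _) (_ : y ∈ OqSing.component q n),
      toSegre q y = segreOf q n ⟨x, hx⟩ := by
  constructor
  · rintro ⟨x, ⟨y, hy, hxy⟩, rfl⟩
    exact ⟨x.2, y, hy, hxy⟩
  · rintro ⟨hx, y, hy, hxy⟩
    exact ⟨⟨x, hx⟩, ⟨y, hy, hxy⟩, rfl⟩

theorem mul_mem_segreRange {m n : ℕ} {x y : Plane q ⊗[ℂ] Plane q} (hx : x ∈ segreRange q m)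
    (hy : y ∈ segreRange q n) : x * y ∈ segreRange q (m + n) := by
  obtain ⟨hx, x', hx', h₁⟩ := mem_segreRange.1 hx
  obtain ⟨hy, y', hy', h₂⟩ := mem_segreRange.1 hy
  refine mem_segreRange.2 ⟨SetLike.mul_mem_graded hx hy, x' * y', ?_, ?_⟩
  · rw [OqSing.component, pow_add]
    exact Submodule.mul_mem_mul hx' hy'
  · rw [map_mul, h₁, h₂, segreOf_mul]

theorem tmul_mem_segreRange_one {x y : Plane q} (hx : x ∈ symq q 1) (hy : y ∈ symq q 1) :
    x ⊗ₜ y ∈ segreRange q 1 := by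
  have h : Submodule.map₂ (TensorProduct.mk ℂ (Plane q) (Plane q)) (symq q 1) (symq q 1) ≤
      segreRange q 1 := by
    rw [symq, pow_one, Submodule.map₂_span_span, Submodule.span_le]
    rintro _ ⟨_, ⟨i, rfl⟩, _, ⟨j, rfl⟩, rfl⟩
    have hg : ∃ g, segreGen q g = SegreAlg.gen q i j := by
      fin_cases i <;> fin_cases j
      exacts [⟨.a, rfl⟩, ⟨.b, rfl⟩, ⟨.c, rfl⟩, ⟨.d, rfl⟩]
    obtain ⟨g, hg⟩ := hg
    refine mem_segreRange.2 ⟨gen_tmul_gen_mem q i j, OqFibre.gen q 0 g, ?_, ?_⟩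
    · rw [OqSing.component, pow_one]
      exact Submodule.subset_span ⟨g, rfl⟩
    · rw [toSegre_gen, hg]
      rfl
  exact h (Submodule.apply_mem_map₂ _ hx hy)

/-- Both factors have the same degree, so both can be split at once: `x₁x₂ ⊗ y₁y₂ = (x₁ ⊗ y₁)(x₂ ⊗
y₂)`, with the last pair in degree 1, where the four generators span. -/
theorem tmul_mem_segreRange {n : ℕ} {x y : Plane q} (hx : x ∈ symq q n) (hy : y ∈ symq q n) :
    x ⊗ₜ y ∈ segreRange q n := by
  induction n generalizing x y with
  | zero =>
    rw [symq, pow_zero] at hx hy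
    obtain ⟨r, rfl⟩ := Submodule.mem_one.1 hx
    obtain ⟨s, rfl⟩ := Submodule.mem_one.1 hy
    have h : (1 : Plane q ⊗[ℂ] Plane q) ∈ segreRange q 0 := by
      refine mem_segreRange.2 ⟨SetLike.one_mem_graded _, 1, ?_, ?_⟩
      · rw [OqSing.component, pow_zero]
        exact Submodule.one_le.1 le_rfl
      · rw [map_one]
        rfl
    rw [Algebra.algebraMap_eq_smul_one, Algebra.algebraMap_eq_smul_one,
      TensorProduct.tmul_smul, ← TensorProduct.smul_tmul']
    exact Submodule.smul_mem _ _ (Submodule.smul_mem _ _ h)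
  | succ n ih =>
    rw [symq, pow_succ] at hx hy
    induction hx using Submodule.mul_induction_on' with
    | add x₁ _ x₂ _ h₁ h₂ => rw [TensorProduct.add_tmul]; exact add_mem h₁ h₂
    | mem_mul_mem x₁ hx₁ x₂ hx₂ =>
      induction hy using Submodule.mul_induction_on' with
      | add y₁ _ y₂ _ h₁ h₂ => rw [TensorProduct.tmul_add]; exact add_mem h₁ h₂
      | mem_mul_mem y₁ hy₁ y₂ hy₂ =>
        rw [← Algebra.TensorProduct.tmul_mul_tmul]
        exact mul_mem_segreRange (ih hx₁ hy₁) (tmul_mem_segreRange_one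
          (by rwa [symq, pow_one]) (by rwa [symq, pow_one]))

theorem segrePiece_le (n : ℕ) : segrePiece q n ≤ segreRange q n := by
  rintro _ ⟨t, rfl⟩
  induction t with
  | zero => rw [map_zero]; exact zero_mem _
  | add s t hs ht => rw [map_add]; exact add_mem hs ht
  | tmul x y => exact tmul_mem_segreRange x.2 y.2

variable (q)

theorem map_toSegre_component (n : ℕ) :
    (OqSing.component q n).map (toSegre q).toLinearMap = SegreAlg.component q n := by
  refine le_antisymm (map_toSegre_component_le q n) ?_
  rintro _ ⟨x, rfl⟩
  obtain ⟨_, y, hy, h⟩ := mem_segreRange.1 (segrePiece_le n x.2)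
  exact ⟨y, hy, h⟩

theorem toSegre_bijective : Function.Bijective (toSegre q) :=
  bijective_of_graded (OqSing.iSup_component q) Function.injective_id
    (fun n hn => absurd ⟨n, rfl⟩ hn) (toSegre q).toLinearMap (map_toSegre_component q)
    fun n => (Nat.cast_le.2 (OqSing.finrank_component_le q n)).trans (le_rank_segrePiece q n)

end Segre

end QuantumSL2

end

/-! ### The main theorem -/

theorem mainTheorem6 (q : ℂˣ) (hq : ∀ n : ℕ, 0 < n → q ^ n ≠ 1) :
    ∃ _ : IsRingFiltration (QuantumSL2.peterWeyl q)
        (QuantumSL2.filtrationLT (QuantumSL2.peterWeyl q)),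
      ∃ (e₁ : QuantumSL2.AssocGraded (QuantumSL2.peterWeyl q) ≃ₐ[ℂ] QuantumSL2.OqSing q)
        (e₂ : QuantumSL2.OqSing q ≃ₐ[ℂ] QuantumSL2.SegreAlg q),
        (∀ g : QuantumSL2.MatGen,
          e₁ (QuantumSL2.grOf (QuantumSL2.peterWeyl q) 1
            ⟨QuantumSL2.OqFibre.gen q 1 g, QuantumSL2.gen_mem_peterWeyl q g⟩) =
              QuantumSL2.OqFibre.gen q 0 g) ∧
        (∀ n : ℕ,
          (QuantumSL2.grComponent (QuantumSL2.peterWeyl q) (n : QuantumSL2.Weight)).map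
            e₁.toLinearMap = QuantumSL2.OqSing.component q n) ∧
        e₂ (QuantumSL2.OqFibre.gen q 0 .a) = QuantumSL2.SegreAlg.gen q 0 0 ∧
        e₂ (QuantumSL2.OqFibre.gen q 0 .b) = QuantumSL2.SegreAlg.gen q 0 1 ∧
        e₂ (QuantumSL2.OqFibre.gen q 0 .c) = QuantumSL2.SegreAlg.gen q 1 0 ∧
        e₂ (QuantumSL2.OqFibre.gen q 0 .d) = QuantumSL2.SegreAlg.gen q 1 1 ∧
        (∀ n : ℕ, (QuantumSL2.OqSing.component q n).map e₂.toLinearMap =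
          QuantumSL2.SegreAlg.component q n) := by
  have hF := QuantumSL2.isRingFiltration_peterWeyl hq
  let e := AlgEquiv.ofBijective (QuantumSL2.toGr q) (QuantumSL2.toGr_bijective hq)
  refine ⟨hF, e.symm, AlgEquiv.ofBijective (QuantumSL2.toSegre q) (QuantumSL2.toSegre_bijective q),
    fun g => e.symm_apply_eq.2 (QuantumSL2.toGr_gen q g).symm, fun n => ?_,
    QuantumSL2.toSegre_gen q .a, QuantumSL2.toSegre_gen q .b, QuantumSL2.toSegre_gen q .c,
    QuantumSL2.toSegre_gen q .d, QuantumSL2.map_toSegre_component q⟩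
  rw [← QuantumSL2.map_toGr_component hq n]
  ext x
  constructor
  · rintro ⟨_, ⟨y, hy, rfl⟩, rfl⟩
    exact (e.symm_apply_apply y).symm ▸ hy
  · exact fun hx => ⟨e x, ⟨x, hx, rfl⟩, e.symm_apply_apply x⟩
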